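/- Let $\mathbb{F}_q$ be a finite field of characteristic $p$, let $m\ge 2$ with $\gcd(p,m)=1$, let $r\ge 1$ and $\lambda$ be integers with $\gcd(m,r\lambda)=1$, and let $\alpha_1,\dots,\alpha_r\in\mathbb{F}_q$ be pairwise distinct. Let $F=\mathbb{F}_q(x,y)$ be the function field over $\mathbb F_q$ (with $x$ transcendental over $\mathbb F_q$) defined by $$y^m=\prod_{i=1}^r (x-\alpha_i)^{\lambda}.$$ Let $P_i$ be the place of $F$ that is a zero of $x-\alpha_i$ ($1\le i\le r$), let $P_\infty$ be the place of $F$ that is a pole of $x$, and let $a,b$ be integers with $ar+bm=1$. For a divisor $D$ of $F$ let $\ell(D)=\dim_{\mathbb{F}_q}\mathcal{L}(D)$, where $\mathcal L(D)=\{f\in F^\times : (f)+D\ge 0\}\cup\{0\}$. Write $\mathbb{N}=\{1,2,\dots\}$ and $\mathbb{N}_0=\mathbb{N}\cup\{0\}$. For distinct rational places $Q_1,Q_2$ of $F$ let $$H(Q_1,Q_2)=\{(s_1,s_2)\in\mathbb{N}_0^2 : \text{there is } f\in F^\times \text{ with pole divisor } (f)_\infty=s_1Q_1+s_2Q_2\}$$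 be the Weierstrass semigroup and let $$G_0(Q_1,Q_2)=\{(s_1,s_2)\in\mathbb{N}^2 : \ell(G)=\ell(G-Q_1)=\ell(G-Q_2)\text{ for } G=s_1Q_1+s_2Q_2\}$$ be the set of pure gaps. Then the following assertions hold. In (1) and (2), which assume $r\ge2$, the places $P_1,P_2$ may be replaced by any $P_i,P_j$ with $i\ne j$, and in (3) and (4) $P_1$ may be replaced by any $P_i$, because the numbering of the $\alpha_i$ is arbitrary. 1. $$H(P_1,P_2)=\Big\{(k,l)\in\mathbb{N}_0^2 : m\Big\lceil\tfrac{k-l}{m}\Big\rceil+m(r-2)\Big\lceil\tfrac{k}{m}\Big\rceil\le kr,\quad m\Big\lceil\tfrac{l-k}{m}\Big\rceil+m(r-2)\Big\lceil\tfrac{l}{m}\Big\rceil\le lr\Big\}.$$ 2. $$G_0(P_1,P_2)=\Big\{(k,l)\in\mathbb{N}^2 : m\Big\lceil\tfrac{k-l}{m}\Big\rceil+m(r-2)\Big\lceil\tfrac{k}{m}\Big\rceil> kr,\quad m\Big\lceil\tfrac{l-k}{m}\Big\rceil+m(r-2)\Big\lceil\tfrac{l}{m}\Big\rceil> lr\Big\}.$$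 3. $$H(P_1,P_\infty)=\Big\{(k,t)\in\mathbb{N}_0^2 : m(r-1)\Big\lceil\tfrac{k}{m}\Big\rceil\le t+kr,\quad m(r-1)\Big\lceil\tfrac{-at}{m}\Big\rceil\le k+(a+bm)t\Big\}.$$ 4. $$G_0(P_1,P_\infty)=\Big\{(k,t)\in\mathbb{N}^2 : m(r-1)\Big\lceil\tfrac{k}{m}\Big\rceil> t+kr,\quad m(r-1)\Big\lceil\tfrac{-at}{m}\Big\rceil> k+(a+bm)t\Big\}.$$ -/

import Mathlib

open scoped WithZero

noncomputable section

/-- A place of the function field `F / K`, given by its normalized discrete valuation: `v` is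
trivial on the constants `K` and takes every value of `ℤᵐ⁰` (so it is onto `ℤ` in additive
notation). -/
structure FnPlace (K F : Type*) [Field K] [Field F] [Algebra K F] where
  /-- the valuation, written multiplicatively: `v f = exp (- v_P f)` -/
  v : Valuation F ℤᵐ⁰
  trivial_on_constants : ∀ c : K, c ≠ 0 → v (algebraMap K F c) = 1
  surjective : Function.Surjective v

namespace FnPlace

variable {K F : Type*} [Field K] [Field F] [Algebra K F]

/-- The order `v_P(f) ∈ ℤ` of a nonzero function at a place: positive at zeros and negative at
poles. (The value at `f = 0` carries no meaning and is never used.) -/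
def ord (P : FnPlace K F) (f : F) : ℤ := -WithZero.log (P.v f)

theorem ord_mul (P : FnPlace K F) {f g : F} (hf : f ≠ 0) (hg : g ≠ 0) :
    P.ord (f * g) = P.ord f + P.ord g := by
  have hf' : P.v f ≠ 0 := (Valuation.ne_zero_iff _).2 hf
  have hg' : P.v g ≠ 0 := (Valuation.ne_zero_iff _).2 hg
  simp only [ord, map_mul, WithZero.log_mul hf' hg']
  ring

theorem ord_algebraMap (P : FnPlace K F) {c : K} (hc : c ≠ 0) :
    P.ord (algebraMap K F c) = 0 := by
  simp [ord, P.trivial_on_constants c hc]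

theorem min_ord_le_ord_add (P : FnPlace K F) {f g : F} (hf : f ≠ 0) (hg : g ≠ 0)
    (hfg : f + g ≠ 0) : min (P.ord f) (P.ord g) ≤ P.ord (f + g) := by
  have hf' : P.v f ≠ 0 := (Valuation.ne_zero_iff _).2 hf
  have hg' : P.v g ≠ 0 := (Valuation.ne_zero_iff _).2 hg
  have hfg' : P.v (f + g) ≠ 0 := (Valuation.ne_zero_iff _).2 hfg
  simp only [ord]
  rcases le_max_iff.1 (P.v.map_add f g) with h | h
  · have := (WithZero.log_le_log hfg' hf').2 h
    exact (min_le_left _ _).trans (by omega)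
  · have := (WithZero.log_le_log hfg' hg').2 h
    exact (min_le_right _ _).trans (by omega)

end FnPlace

/-- Divisors: the free abelian group on the places. -/
abbrev FnDivisor (K F : Type*) [Field K] [Field F] [Algebra K F] := FnPlace K F →₀ ℤ

section

variable {K F : Type*} [Field K] [Field F] [Algebra K F]

/-- The Riemann-Roch space `𝓛(D) = {f | (f) + D ≥ 0} ∪ {0}`. -/
def riemannRochSpace (D : FnDivisor K F) : Submodule K F where
  carrier := {f | f ≠ 0 → ∀ P : FnPlace K F, 0 ≤ P.ord f + D P}
  zero_mem' := fun h => absurd rfl h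
  add_mem' := by
    intro f g hf hg hfg P
    by_cases hf0 : f = 0
    · subst hf0
      rw [zero_add] at hfg ⊢
      exact hg hfg P
    by_cases hg0 : g = 0
    · subst hg0
      rw [add_zero] at hfg ⊢
      exact hf hfg P
    have h1 := hf hf0 P
    have h2 := hg hg0 P
    have h3 := P.min_ord_le_ord_add hf0 hg0 hfg
    rcases min_le_iff.1 h3 with h | h <;> omega
  smul_mem' := by
    intro c f hf hcf P
    rw [Algebra.smul_def] at hcf ⊢
    have hf0 : f ≠ 0 := right_ne_zero_of_mul hcf
    have hc0 : c ≠ 0 := by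
      rintro rfl
      simp at hcf
    rw [P.ord_mul (left_ne_zero_of_mul hcf) hf0, P.ord_algebraMap hc0, zero_add]
    exact hf hf0 P

/-- `ℓ(D)`, the dimension of `𝓛(D)` over the constant field. -/
def ell (D : FnDivisor K F) : ℕ := Module.finrank K (riemannRochSpace D)

/-- The coefficients of the divisor of poles `(f)_∞` of a nonzero function `f`. -/
def poleDivisor (f : F) : FnPlace K F → ℤ := fun P => max 0 (-P.ord f)

/-- The divisor `s₁ Q₁ + ⋯ + s_l Q_l`. -/
def sumDivisor {l : ℕ} (Q : Fin l → FnPlace K F) (s : Fin l → ℕ) : FnDivisor K F :=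
  ∑ i, Finsupp.single (Q i) (s i : ℤ)

/-- The Weierstrass semigroup `H(Q₁, …, Q_l)`: the tuples `s ∈ ℕ₀^l` such that some nonzero `f`
has divisor of poles `s₁ Q₁ + ⋯ + s_l Q_l`. -/
def weierstrassSemigroup {l : ℕ} (Q : Fin l → FnPlace K F) : Set (Fin l → ℕ) :=
  {s | ∃ f : F, f ≠ 0 ∧ poleDivisor f = ⇑(sumDivisor Q s)}

/-- The pure gap set `G₀(Q₁, …, Q_l)`: the tuples `s` of positive integers such that
`ℓ(G) = ℓ(G - Q_j)` for all `j`, where `G = s₁ Q₁ + ⋯ + s_l Q_l`. -/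
def pureGapSet {l : ℕ} (Q : Fin l → FnPlace K F) : Set (Fin l → ℕ) :=
  {s | (∀ j, 0 < s j) ∧
    ∀ j, ell (sumDivisor Q s) = ell (sumDivisor Q s - Finsupp.single (Q j) 1)}

end

end

/-! Since `lam` is prime to `m`, Bezout exponents replace `y` by a generator `z` with `z ^ m = B`,
where `B = ∏ (x - α_i)`. As `r` is prime to `m`, the places `P_i` and `P_∞` are totally ramified
over `K(x)`: `z` has order `1` at each `P_i` and `-r` at `P_∞`.

A function regular outside these places becomes, after multiplication by a power of `B`, a sum of
terms `p_t(x) z ^ t` with `t < m` (`exists_mul_branchPoly_pow_eq`). At each `P_i` and at `P_∞` the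
nonzero terms have orders distinct mod `m`, so the order of the sum is the least order of a term.
Hence if some function in `𝓛(G)` has exact order `-G(Q)` at one of these places `Q`, a single term
does too, and that term can be traded for a monomial `∏ (x - α_i) ^ n_i * z ^ c`
(`attainsAt_zero_iff`, `attainsAt_infty_iff`). What remains is a system of integer inequalities,
solvable exactly when it is solved by the least admissible exponents; these are the ceilings.

A pair lies in the semigroup iff the order is attained at both places
(`mem_weierstrassSemigroup_pair_iff`), and is a pure gap iff both entries are positive and it is
attained at neither (`mem_pureGapSet_pair_iff`). -/

noncomputable section

/-! ### Orders at a place, and orders of polynomials in `x`. -/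

namespace FnPlace

open Polynomial

variable {K F : Type*} [Field K] [Field F] [Algebra K F]

theorem v_ne_zero (P : FnPlace K F) {f : F} (hf : f ≠ 0) : P.v f ≠ 0 :=
  (Valuation.ne_zero_iff _).2 hf

theorem v_lt_v_iff (P : FnPlace K F) {f g : F} (hf : f ≠ 0) (hg : g ≠ 0) :
    P.v f < P.v g ↔ P.ord g < P.ord f := by
  rw [ord, ord, neg_lt_neg_iff, WithZero.log_lt_log (P.v_ne_zero hf) (P.v_ne_zero hg)]

theorem v_le_v_iff (P : FnPlace K F) {f g : F} (hf : f ≠ 0) (hg : g ≠ 0) :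
    P.v f ≤ P.v g ↔ P.ord g ≤ P.ord f := by
  rw [ord, ord, neg_le_neg_iff, WithZero.log_le_log (P.v_ne_zero hf) (P.v_ne_zero hg)]

theorem ord_eq_of_v_eq (P : FnPlace K F) {f g : F} (h : P.v f = P.v g) : P.ord f = P.ord g := by
  rw [ord, ord, h]

@[simp] theorem ord_one (P : FnPlace K F) : P.ord (1 : F) = 0 := by simp [ord]

theorem ord_neg (P : FnPlace K F) (f : F) : P.ord (-f) = P.ord f :=
  P.ord_eq_of_v_eq (Valuation.map_neg _ _)

theorem ord_inv (P : FnPlace K F) {f : F} (hf : f ≠ 0) : P.ord f⁻¹ = -P.ord f := by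
  have := P.ord_mul hf (inv_ne_zero hf)
  rw [mul_inv_cancel₀ hf, ord_one] at this
  omega

theorem ord_div (P : FnPlace K F) {f g : F} (hf : f ≠ 0) (hg : g ≠ 0) :
    P.ord (f / g) = P.ord f - P.ord g := by
  rw [div_eq_mul_inv, P.ord_mul hf (inv_ne_zero hg), P.ord_inv hg, sub_eq_add_neg]

theorem ord_pow (P : FnPlace K F) {f : F} (hf : f ≠ 0) (n : ℕ) : P.ord (f ^ n) = n * P.ord f := by
  induction n with
  | zero => simp
  | succ n ih =>
    rw [pow_succ, P.ord_mul (pow_ne_zero n hf) hf, ih]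
    push_cast
    ring

theorem ord_zpow (P : FnPlace K F) {f : F} (hf : f ≠ 0) (n : ℤ) :
    P.ord (f ^ n) = n * P.ord f := by
  cases n with
  | ofNat n => simpa using P.ord_pow hf n
  | negSucc n =>
    rw [zpow_negSucc, P.ord_inv (pow_ne_zero _ hf), P.ord_pow hf, Int.negSucc_eq]
    push_cast
    ring

theorem ord_prod (P : FnPlace K F) {ι : Type*} (s : Finset ι) (f : ι → F)
    (hf : ∀ i ∈ s, f i ≠ 0) : P.ord (∏ i ∈ s, f i) = ∑ i ∈ s, P.ord (f i) := by
  classical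
  induction s using Finset.induction_on with
  | empty => simp
  | insert i s hi ih =>
    rw [Finset.prod_insert hi, Finset.sum_insert hi,
      P.ord_mul (hf i (Finset.mem_insert_self _ _))
        (Finset.prod_ne_zero_iff.2 fun j hj => hf j (Finset.mem_insert_of_mem hj)),
      ih fun j hj => hf j (Finset.mem_insert_of_mem hj)]

theorem ord_add_of_lt (P : FnPlace K F) {f g : F} (hf : f ≠ 0) (hg : g ≠ 0)
    (h : P.ord f < P.ord g) : P.ord (f + g) = P.ord f :=
  P.ord_eq_of_v_eq (Valuation.map_add_eq_of_lt_left _ ((P.v_lt_v_iff hg hf).2 h))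

theorem ext_ord {P Q : FnPlace K F} (h : ∀ f : F, f ≠ 0 → P.ord f = Q.ord f) : P = Q := by
  have hv : P.v = Q.v := by
    ext f
    rcases eq_or_ne f 0 with rfl | hf
    · simp
    · have h1 := h f hf
      rw [ord, ord, neg_inj] at h1
      rw [← WithZero.exp_log (P.v_ne_zero hf), h1, WithZero.exp_log (Q.v_ne_zero hf)]
  cases P
  cases Q
  simpa using hv

theorem exists_ord_eq (P : FnPlace K F) (n : ℤ) : ∃ f : F, f ≠ 0 ∧ P.ord f = n := by
  obtain ⟨f, hf⟩ := P.surjective (WithZero.exp (-n))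
  refine ⟨f, ?_, ?_⟩
  · rintro rfl
    rw [map_zero] at hf
    exact WithZero.exp_ne_zero hf.symm
  · rw [ord, hf, WithZero.log_exp, neg_neg]

/-- A sum whose nonzero terms have pairwise distinct orders has the least of these orders. -/
theorem exists_ord_sum_eq (P : FnPlace K F) {ι : Type*} (s : Finset ι) (f : ι → F)
    (hf : ∀ i ∈ s, ∀ j ∈ s, f i ≠ 0 → f j ≠ 0 → P.ord (f i) = P.ord (f j) → i = j)
    (hne : ∃ i ∈ s, f i ≠ 0) :
    ∑ i ∈ s, f i ≠ 0 ∧ ∃ j ∈ s, f j ≠ 0 ∧ P.ord (∑ i ∈ s, f i) = P.ord (f j) ∧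
      ∀ i ∈ s, f i ≠ 0 → P.ord (f j) ≤ P.ord (f i) := by
  classical
  obtain ⟨i₀, hi₀, hfi₀⟩ := hne
  obtain ⟨j, hj, hmax⟩ := Finset.exists_max_image s (fun i => P.v (f i)) ⟨i₀, hi₀⟩
  have hj0 : f j ≠ 0 := by
    intro h
    have := hmax i₀ hi₀
    rw [h, map_zero, le_zero_iff] at this
    exact P.v_ne_zero hfi₀ this
  have hsum : P.v (∑ i ∈ s, f i) = P.v (f j) := by
    refine Valuation.map_sum_eq_of_lt _ hj fun i hi => ?_
    rw [Finset.mem_sdiff, Finset.mem_singleton] at hi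
    rcases eq_or_ne (f i) 0 with h0 | h0
    · rw [h0, map_zero]
      exact zero_lt_iff.2 (P.v_ne_zero hj0)
    · refine lt_of_le_of_ne (hmax i hi.1) fun h => hi.2 ?_
      exact hf i hi.1 j hj h0 hj0 (P.ord_eq_of_v_eq h)
  refine ⟨fun h => ?_, j, hj, hj0, P.ord_eq_of_v_eq hsum, fun i hi h0 => ?_⟩
  · rw [h, map_zero] at hsum
    exact P.v_ne_zero hj0 hsum.symm
  · exact (P.v_le_v_iff h0 hj0).1 (hmax i hi)

theorem v_aeval_le_one (P : FnPlace K F) {x : F} (hx0 : x ≠ 0) (hx : 0 ≤ P.ord x) (p : K[X]) :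
    P.v (aeval x p) ≤ 1 := by
  have hv : P.v x ≤ 1 := by
    rw [← P.v.map_one, P.v_le_v_iff hx0 one_ne_zero]
    simpa using hx
  rw [aeval_eq_sum_range]
  refine Valuation.map_sum_le _ fun i _ => ?_
  rw [Algebra.smul_def, map_mul, map_pow]
  refine mul_le_one' ?_ (pow_le_one' hv i)
  rcases eq_or_ne (p.coeff i) 0 with h | h
  · simp [h]
  · rw [P.trivial_on_constants _ h]

theorem ord_sub_algebraMap_of_ord_pos (P : FnPlace K F) {x : F} {a c : K}
    (h : 0 < P.ord (x - algebraMap K F a)) (hx : x - algebraMap K F a ≠ 0) (hc : c ≠ a) :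
    P.ord (x - algebraMap K F c) = 0 := by
  have hac : a - c ≠ 0 := sub_ne_zero.2 hc.symm
  have h1 : algebraMap K F (a - c) ≠ 0 := (_root_.map_ne_zero _).2 hac
  have : x - algebraMap K F c = algebraMap K F (a - c) + (x - algebraMap K F a) := by
    rw [map_sub]; ring
  rw [this, P.ord_add_of_lt h1 hx (by rwa [P.ord_algebraMap hac]), P.ord_algebraMap hac]

theorem ord_aeval_of_eval_ne_zero (P : FnPlace K F) {x : F} {a : K}
    (h : 0 < P.ord (x - algebraMap K F a)) {p : K[X]} (hp : p.eval a ≠ 0) : P.ord (aeval x p) = 0 := by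
  obtain ⟨q, hq⟩ := X_sub_C_dvd_sub_C_eval (a := a) (p := p)
  have hp' : p = C (p.eval a) + (X - C a) * q := by rw [← hq]; ring
  have he : aeval x p = algebraMap K F (p.eval a) + (x - algebraMap K F a) * aeval x q := by
    conv_lhs => rw [hp']
    simp
  have hx0 : x - algebraMap K F a ≠ 0 := fun h0 => by simp [h0, ord] at h
  have hord : 0 ≤ P.ord (x - algebraMap K F a) := h.le
  -- Rewriting `q` as a polynomial in `x - a`, whose order is known to be nonnegative, bounds its
  -- value.
  have hq1 : P.v (aeval x q) ≤ 1 := by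
    have := P.v_aeval_le_one hx0 hord (q.comp (X + C a))
    simpa [aeval_comp] using this
  have h1 : algebraMap K F (p.eval a) ≠ 0 := by simpa using hp
  rcases eq_or_ne (aeval x q) 0 with h0 | h0
  · rw [he, h0, mul_zero, add_zero, P.ord_algebraMap hp]
  · have hq2 : 0 ≤ P.ord (aeval x q) := by
      rw [← P.v.map_one, P.v_le_v_iff h0 one_ne_zero] at hq1
      simpa using hq1
    rw [he, P.ord_add_of_lt h1 (mul_ne_zero hx0 h0), P.ord_algebraMap hp]
    rw [P.ord_algebraMap hp, P.ord_mul hx0 h0]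
    omega

theorem ord_aeval_of_ord_pos (P : FnPlace K F) {x : F} {a : K}
    (h : 0 < P.ord (x - algebraMap K F a)) (hx : Transcendental K x) {p : K[X]} (hp : p ≠ 0) :
    P.ord (aeval x p) = P.ord (x - algebraMap K F a) * p.rootMultiplicity a := by
  obtain ⟨q, hq, hdvd⟩ := exists_eq_pow_rootMultiplicity_mul_and_not_dvd p hp a
  rw [dvd_iff_isRoot, IsRoot.def] at hdvd
  have hx0 : x - algebraMap K F a ≠ 0 := fun h0 => by simp [h0, ord] at h
  have hq0 : aeval x q ≠ 0 := fun h0 => by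
    have := transcendental_iff.1 hx q h0
    simp [this] at hdvd
  have he : aeval x p = (x - algebraMap K F a) ^ p.rootMultiplicity a * aeval x q := by
    conv_lhs => rw [hq]
    simp
  rw [he, P.ord_mul (pow_ne_zero _ hx0) hq0, P.ord_pow hx0,
    P.ord_aeval_of_eval_ne_zero h hdvd]
  ring

/-- At a pole of `x` the monomials have distinct orders, and the leading one has the smallest. -/
theorem ord_aeval_of_ord_neg (P : FnPlace K F) {x : F} (h : P.ord x < 0) {p : K[X]} (hp : p ≠ 0) :
    P.ord (aeval x p) = P.ord x * p.natDegree := by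
  have hx0 : x ≠ 0 := fun h0 => by simp [h0, ord] at h
  have hterm : ∀ i ∈ p.support,
      p.coeff i • x ^ i ≠ 0 ∧ P.ord (p.coeff i • x ^ i) = i * P.ord x := by
    intro i hi
    have hc : algebraMap K F (p.coeff i) ≠ 0 := by simpa using mem_support_iff.1 hi
    rw [Algebra.smul_def]
    refine ⟨mul_ne_zero hc (pow_ne_zero _ hx0), ?_⟩
    rw [P.ord_mul hc (pow_ne_zero _ hx0), P.ord_algebraMap (mem_support_iff.1 hi), zero_add,
      P.ord_pow hx0]
  have hdeg := natDegree_mem_support_of_nonzero hp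
  obtain ⟨-, j, hj, -, hj1, hj2⟩ := P.exists_ord_sum_eq p.support (fun i => p.coeff i • x ^ i)
    (fun i hi j hj _ _ hij => by
      rw [(hterm i hi).2, (hterm j hj).2] at hij
      exact_mod_cast mul_right_cancel₀ h.ne hij)
    ⟨_, hdeg, (hterm _ hdeg).1⟩
  have he : aeval x p = ∑ i ∈ p.support, p.coeff i • x ^ i := by
    rw [aeval_eq_sum_range' (Nat.lt_succ_self _)]
    symm
    refine Finset.sum_subset supp_subset_range_natDegree_succ fun i _ hi => ?_
    rw [notMem_support_iff.1 hi, zero_smul]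
  have h3 := hj2 _ hdeg (hterm _ hdeg).1
  rw [(hterm _ hj).2, (hterm _ hdeg).2] at h3
  have h4 : j ≤ p.natDegree := le_natDegree_of_mem_supp _ hj
  have h5 : p.natDegree ≤ j := by
    by_contra hlt
    push Not at hlt
    have : (j : ℤ) < p.natDegree := by exact_mod_cast hlt
    nlinarith
  rw [he, hj1, (hterm _ hj).2, le_antisymm h4 h5]
  ring

end FnPlace

/-! ### Expansions in powers of `z` at a totally ramified place. -/

namespace FnPlace

open Polynomial

variable {K F : Type*} [Field K] [Field F] [Algebra K F]

/-- The place `P` is totally ramified in the degree `m` extension `K(x, z)` of `K(x)`: its orders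
on `K[x]` are `m` times those of the order function `w` and the order `c` of `z` is coprime to `m`,
up to a common factor `u`. -/
structure IsTotallyRamified (P : FnPlace K F) (x z : F) (m : ℕ) (w : K[X] → ℤ) (c u : ℤ) :
    Prop where
  pos : 0 < u
  coprime : IsCoprime c m
  ord_aeval : ∀ p : K[X], p ≠ 0 → P.ord (aeval x p) = u * (m * w p)
  ord_gen : P.ord z = u * c

/-- The element `∑_{t < m} p_t(x) z ^ t`. -/
def powSum (x z : F) (m : ℕ) (p : ℕ → K[X]) : F := ∑ t ∈ Finset.range m, aeval x (p t) * z ^ t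

namespace IsTotallyRamified

variable {P : FnPlace K F} {x z : F} {m : ℕ} {w : K[X] → ℤ} {c u : ℤ}

theorem ord_term (h : P.IsTotallyRamified x z m w c u) (hx : Transcendental K x) (hz : z ≠ 0)
    {p : K[X]} (hp : p ≠ 0) (t : ℕ) :
    aeval x p * z ^ t ≠ 0 ∧ P.ord (aeval x p * z ^ t) = u * (m * w p + c * t) := by
  have hp' : aeval x p ≠ 0 := fun h0 => hp (transcendental_iff.1 hx p h0)
  refine ⟨mul_ne_zero hp' (pow_ne_zero _ hz), ?_⟩
  rw [P.ord_mul hp' (pow_ne_zero _ hz), P.ord_pow hz, h.ord_aeval p hp, h.ord_gen]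
  ring

/-- Up to the factor `u`, the `t`-th term has order congruent to `c * t` mod `m`. As `c` is prime to
`m` and `t < m`, these residues differ, so no cancellation occurs. -/
theorem exists_ord_powSum (h : P.IsTotallyRamified x z m w c u) (hx : Transcendental K x)
    (hz : z ≠ 0) (p : ℕ → K[X]) (hp : ∃ t < m, p t ≠ 0) :
    powSum x z m p ≠ 0 ∧ ∃ t < m, p t ≠ 0 ∧
      P.ord (powSum x z m p) = u * (m * w (p t) + c * t) ∧
      ∀ s < m, p s ≠ 0 → P.ord (powSum x z m p) ≤ u * (m * w (p s) + c * s) := by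
  obtain ⟨t₀, ht₀, hpt₀⟩ := hp
  have hne : ∀ t, aeval x (p t) * z ^ t ≠ 0 → p t ≠ 0 := by
    rintro t ht h0
    simp [h0] at ht
  obtain ⟨h1, t, ht, hpt, h2, h3⟩ :=
    P.exists_ord_sum_eq (Finset.range m) (fun t => aeval x (p t) * z ^ t)
      (fun i hi j hj hi0 hj0 hij => by
        rw [(h.ord_term hx hz (hne i hi0) i).2, (h.ord_term hx hz (hne j hj0) j).2] at hij
        have hij' := mul_left_cancel₀ h.pos.ne' hij
        have hdvd : (m : ℤ) ∣ c * ((i : ℤ) - j) := ⟨w (p j) - w (p i), by linear_combination hij'⟩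
        have hdvd' := h.coprime.symm.dvd_of_dvd_mul_left hdvd
        rw [Finset.mem_range] at hi hj
        have := Int.eq_zero_of_abs_lt_dvd hdvd' (by rw [abs_lt]; omega)
        omega)
      ⟨t₀, Finset.mem_range.2 ht₀, (h.ord_term hx hz hpt₀ t₀).1⟩
  refine ⟨h1, t, Finset.mem_range.1 ht, hne t hpt, ?_, fun s hs hs0 => ?_⟩
  · rw [powSum, h2, (h.ord_term hx hz (hne t hpt) t).2]
  · rw [powSum, h2, ← (h.ord_term hx hz hs0 s).2]
    exact h3 s (Finset.mem_range.2 hs) (h.ord_term hx hz hs0 s).1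

theorem eq_zero_of_powSum_eq_zero (h : P.IsTotallyRamified x z m w c u)
    (hx : Transcendental K x) (hz : z ≠ 0) (p : ℕ → K[X]) (hp : powSum x z m p = 0) (t : ℕ)
    (ht : t < m) : p t = 0 := by
  by_contra h0
  exact (h.exists_ord_powSum hx hz p ⟨t, ht, h0⟩).1 hp

theorem exists_of_powSum_ne_zero {p : ℕ → K[X]} (hp : powSum x z m p ≠ 0) : ∃ t < m, p t ≠ 0 := by
  by_contra! h0
  exact hp (Finset.sum_eq_zero fun t ht => by simp [h0 t (Finset.mem_range.1 ht)])

theorem ord_powSum_le {Q : FnPlace K F} {v : ℤ}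
    (h : P.IsTotallyRamified x z m w c u) (h' : Q.IsTotallyRamified x z m w c v)
    (huv : u = v) (hx : Transcendental K x)
    (hz : z ≠ 0) (p : ℕ → K[X]) (hp : powSum x z m p ≠ 0) :
    Q.ord (powSum x z m p) ≤ P.ord (powSum x z m p) := by
  obtain ⟨-, t, ht, hpt, h1, -⟩ := h.exists_ord_powSum hx hz p (exists_of_powSum_ne_zero hp)
  obtain ⟨-, -, -, -, -, h2⟩ := h'.exists_ord_powSum hx hz p (exists_of_powSum_ne_zero hp)
  rw [h1, huv]
  exact h2 t ht hpt

/-- All orders are multiples of `u`, yet a normalized valuation takes the value `1`. -/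
theorem index_eq_one (h : P.IsTotallyRamified x z m w c u) (hx : Transcendental K x)
    (hz : z ≠ 0)
    (hF : ∀ f : F, ∃ p q : ℕ → K[X], powSum x z m q ≠ 0 ∧ f = powSum x z m p / powSum x z m q) :
    u = 1 := by
  obtain ⟨f, hf0, hf⟩ := P.exists_ord_eq 1
  obtain ⟨p, q, hq, rfl⟩ := hF f
  have hp : powSum x z m p ≠ 0 := fun h0 => hf0 (by rw [h0, zero_div])
  obtain ⟨-, t, -, -, h1, -⟩ := h.exists_ord_powSum hx hz p (exists_of_powSum_ne_zero hp)
  obtain ⟨-, s, -, -, h2, -⟩ := h.exists_ord_powSum hx hz q (exists_of_powSum_ne_zero hq)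
  rw [P.ord_div hp hq, h1, h2, ← mul_sub] at hf
  exact Int.eq_one_of_mul_eq_one_right h.pos.le hf

/-- The data `w` and `c` determine the order of every expansion, hence of every quotient of
expansions. -/
theorem place_eq {Q : FnPlace K F} {v : ℤ} (h : P.IsTotallyRamified x z m w c u)
    (h' : Q.IsTotallyRamified x z m w c v) (hx : Transcendental K x) (hz : z ≠ 0)
    (hF : ∀ f : F, ∃ p q : ℕ → K[X], powSum x z m q ≠ 0 ∧ f = powSum x z m p / powSum x z m q) :
    P = Q := by
  have huv : u = v := (h.index_eq_one hx hz hF).trans (h'.index_eq_one hx hz hF).symm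
  refine ext_ord fun f hf => ?_
  obtain ⟨p, q, hq, rfl⟩ := hF f
  have hp : powSum x z m p ≠ 0 := fun h0 => hf (by rw [h0, zero_div])
  rw [P.ord_div hp hq, Q.ord_div hp hq,
    le_antisymm (h'.ord_powSum_le h huv.symm hx hz p hp) (h.ord_powSum_le h' huv hx hz p hp),
    le_antisymm (h'.ord_powSum_le h huv.symm hx hz q hq) (h.ord_powSum_le h' huv hx hz q hq)]

end IsTotallyRamified

end FnPlace

/-! ### Every function is a quotient of expansions. -/

section

open Polynomial FnPlace

variable {K F : Type*} [Field K] [Field F] [Algebra K F]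

/-- Multiplication by a power of `z` keeps the set of sums `∑_{t < m} p_t(x) z ^ t`. -/
theorem exists_powSum_eq_aeval_mul_pow {x z : F} {m : ℕ} (hm : 0 < m) {f : K[X]}
    (hz : z ^ m = aeval x f) (p : K[X]) (n : ℕ) :
    ∃ q : ℕ → K[X], aeval x p * z ^ n = powSum x z m q := by
  refine ⟨Pi.single (n % m) (p * f ^ (n / m)), ?_⟩
  rw [powSum, Finset.sum_eq_single (n % m)]
  · conv_lhs => rw [← Nat.div_add_mod n m, pow_add, pow_mul, hz]
    simp [mul_assoc]
  · intro t _ ht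
    simp [ht]
  · intro h
    exact absurd (Finset.mem_range.2 (Nat.mod_lt _ hm)) h

theorem powSum_add (x z : F) (m : ℕ) (p q : ℕ → K[X]) :
    powSum x z m (p + q) = powSum x z m p + powSum x z m q := by
  simp [powSum, add_mul, Finset.sum_add_distrib]

theorem exists_powSum_eq_powSum {x z : F} {m : ℕ} (hm : 0 < m) {f : K[X]}
    (hz : z ^ m = aeval x f) (n : ℕ) (s : ℕ → K[X]) :
    ∃ p : ℕ → K[X], powSum x z n s = powSum x z m p := by
  induction n with
  | zero => exact ⟨0, by simp [powSum]⟩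
  | succ n ih =>
    obtain ⟨p, hp⟩ := ih
    obtain ⟨q, hq⟩ := exists_powSum_eq_aeval_mul_pow hm hz (s n) n
    exact ⟨p + q, by rw [powSum_add, ← hp, ← hq, powSum, Finset.sum_range_succ, powSum]⟩

theorem exists_powSum_of_mem_adjoin {x z : F} {m : ℕ} (hm : 0 < m) {f : K[X]}
    (hz : z ^ m = aeval x f) {g : F} (hg : g ∈ Algebra.adjoin K {x, z}) :
    ∃ p : ℕ → K[X], g = powSum x z m p := by
  have key : ∃ s : ℕ → K[X], ∃ n, g = powSum x z n s := by
    rw [show ({x, z} : Set F) = {x} ∪ {z} from rfl, Algebra.adjoin_union_eq_adjoin_adjoin] at hg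
    change g ∈ Algebra.adjoin (Algebra.adjoin K {x}) {z} at hg
    rw [Algebra.adjoin_singleton_eq_range_aeval (Algebra.adjoin K {x}) z, AlgHom.mem_range] at hg
    obtain ⟨P, rfl⟩ := hg
    have hc : ∀ a : Algebra.adjoin K {x}, ∃ s : K[X], aeval x s = (a : F) := by
      rintro ⟨a, ha⟩
      rwa [Algebra.adjoin_singleton_eq_range_aeval] at ha
    choose s hs using hc
    refine ⟨fun t => s (P.coeff t), P.natDegree + 1, ?_⟩
    rw [aeval_eq_sum_range, powSum]
    refine Finset.sum_congr rfl fun t _ => ?_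
    rw [hs, Algebra.smul_def]
    rfl
  obtain ⟨s, n, rfl⟩ := key
  exact exists_powSum_eq_powSum hm hz n s

theorem exists_eq_powSum_div_powSum {x z : F} {m : ℕ} (hm : 0 < m) {f : K[X]}
    (hz : z ^ m = aeval x f) (hgen : IntermediateField.adjoin K {x, z} = ⊤) (g : F) :
    ∃ p q : ℕ → K[X], powSum x z m q ≠ 0 ∧ g = powSum x z m p / powSum x z m q := by
  have hg : g ∈ IntermediateField.adjoin K {x, z} := by rw [hgen]; trivial
  have key : ∃ p q : F, p ∈ Algebra.adjoin K {x, z} ∧ q ∈ Algebra.adjoin K {x, z} ∧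
      q ≠ 0 ∧ g = p / q := by
    obtain ⟨p, hp, q, hq, rfl⟩ := IntermediateField.mem_adjoin_iff_div.1 hg
    -- The quotient may have denominator `0`, with value `0` by convention; it is then rewritten as
    -- `0 / 1`.
    rcases eq_or_ne q 0 with rfl | h0
    · exact ⟨0, 1, zero_mem _, one_mem _, one_ne_zero, by simp⟩
    · exact ⟨p, q, hp, hq, h0, rfl⟩
  obtain ⟨p, q, hp, hq, hq0, rfl⟩ := key
  obtain ⟨p', rfl⟩ := exists_powSum_of_mem_adjoin hm hz hp
  obtain ⟨q', rfl⟩ := exists_powSum_of_mem_adjoin hm hz hq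
  exact ⟨p', q', hq0, rfl⟩

end

/-! ### Integrality over `K[x]` and the discriminant bound on denominators. -/

section

open Polynomial FnPlace IntermediateField

variable {K F : Type*} [Field K] [Field F] [Algebra K F]

/-- Independence of `1, …, z ^ (m - 1)` forces degree at least `m` over `A`; since `A` is integrally
closed, the minimal polynomial over `E` is the same. -/
theorem minpoly_eq_X_pow_sub_C {A E : Type*} [CommRing A] [IsDomain A] [IsIntegrallyClosed A]
    [Field E] [Algebra A E] [IsFractionRing A E] [Algebra A F] [Algebra E F]
    [IsScalarTower A E F] {m : ℕ} (hm : 0 < m) {z : F} {f : A} (hz : z ^ m = algebraMap A F f)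
    (hli : ∀ p : ℕ → A, ∑ t ∈ Finset.range m, algebraMap A F (p t) * z ^ t = 0 →
      ∀ t < m, p t = 0) :
    minpoly E z = X ^ m - C (algebraMap A E f) := by
  have hinj : Function.Injective (algebraMap A F) := by
    rw [IsScalarTower.algebraMap_eq A E F]
    exact (algebraMap E F).injective.comp (IsFractionRing.injective A E)
  have : Module.IsTorsionFree A F := Module.isTorsionFree_iff_algebraMap_injective.2 hinj
  have hroot : aeval z (X ^ m - C f) = 0 := by simp [hz]
  have hmonic : (X ^ m - C f).Monic := monic_X_pow_sub_C f hm.ne'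
  have hint : IsIntegral A z := ⟨_, hmonic, by rwa [← aeval_def]⟩
  have hdeg : m ≤ (minpoly A z).natDegree := by
    by_contra! hlt
    have h0 := minpoly.aeval A z
    rw [aeval_eq_sum_range' hlt] at h0
    simp_rw [Algebra.smul_def] at h0
    have h1 := hli _ h0 _ hlt
    rw [coeff_natDegree, (minpoly.monic hint).leadingCoeff] at h1
    exact one_ne_zero h1
  have heq : X ^ m - C f = minpoly A z :=
    eq_of_monic_of_dvd_of_natDegree_le (minpoly.monic hint) hmonic
      (minpoly.isIntegrallyClosed_dvd hint hroot) (by rwa [natDegree_X_pow_sub_C])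
  rw [minpoly.isIntegrallyClosed_eq_field_fractions' E hint, ← heq]
  simp

/-- The power basis `1, z, …, z ^ (m - 1)` of a Kummer-like extension has discriminant
`f ^ (m - 1)` up to a constant factor. -/
theorem exists_discr_eq {E L : Type*} [Field E] [Field L] [Algebra K[X] E] [Algebra E L] {m : ℕ} (hm : 0 < m)
    (hmK : (m : K) ≠ 0) {f : K[X]} (B : PowerBasis E L) [Module.Finite E L]
    [Algebra.IsSeparable E L] (hB : minpoly E B.gen = X ^ m - C (algebraMap K[X] E f)) :
    ∃ c : K, c ≠ 0 ∧ Algebra.discr E B.basis = algebraMap K[X] E (C c * f ^ (m - 1)) := by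
  rw [Algebra.discr_powerBasis_eq_norm, hB]
  -- The discriminant is, up to sign, the norm of the derivative `m z ^ (m - 1)`, and `z` has norm
  -- `± f`.
  have h1 : aeval B.gen (derivative (X ^ m - C (algebraMap K[X] E f))) =
      algebraMap E L (m : E) * B.gen ^ (m - 1) := by
    simp [derivative_X_pow]
  have h2 : Algebra.norm E B.gen = (-1) ^ B.dim * (-algebraMap K[X] E f) := by
    rw [Algebra.PowerBasis.norm_gen_eq_coeff_zero_minpoly, hB]
    simp [coeff_X_pow, hm.ne]
  rw [h1, map_mul, map_pow, h2, Algebra.norm_algebraMap]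
  refine ⟨(-1) ^ (Module.finrank E L * (Module.finrank E L - 1) / 2) *
    ((m : K) ^ Module.finrank E L * ((-1) ^ B.dim * (-1)) ^ (m - 1)), ?_, ?_⟩
  · simp [hmK]
  · simp only [map_mul, map_pow, map_neg, map_one, map_natCast]
    ring

/-- The place of `F` given by a maximal ideal of a Dedekind domain with fraction field `F`
containing the constants. -/
def FnPlace.ofHeightOneSpectrum {C : Type*} [CommRing C] [IsDedekindDomain C] [Algebra C F]
    [IsFractionRing C F] (hC : ∀ c : K, algebraMap K F c ∈ (algebraMap C F).range)
    (v : IsDedekindDomain.HeightOneSpectrum C) : FnPlace K F where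
  v := v.valuation F
  trivial_on_constants c hc := by
    have hle : ∀ c : K, v.valuation F (algebraMap K F c) ≤ 1 := fun c => by
      obtain ⟨d, hd⟩ := hC c
      rw [← hd]
      exact v.valuation_le_one d
    have hmul : v.valuation F (algebraMap K F c) * v.valuation F (algebraMap K F c⁻¹) = 1 := by
      rw [← map_mul, ← map_mul, mul_inv_cancel₀ hc, map_one, map_one]
    refine le_antisymm (hle c) ?_
    rw [← hmul]
    exact mul_le_of_le_one_right' (hle _)
  surjective := v.valuation_surjective F

/-- A function regular wherever `x` is regular is integral over `K[x]`, and the discriminant of the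
basis of powers of `z` carries integral elements into `K[x][z]`. The condition `(m : K) ≠ 0` makes
the extension separable and the discriminant nonzero. -/
theorem exists_powSum_eq_mul_pow_aux {E : Type*} [Field E] [Algebra K[X] E]
    [IsFractionRing K[X] E] [Algebra K[X] F] [Algebra E F] [IsScalarTower K[X] E F]
    {x z : F} (hx : ∀ p : K[X], algebraMap K[X] F p = aeval x p) {m : ℕ} (hm : 0 < m)
    (hmK : (m : K) ≠ 0) {f : K[X]} (hf : f ≠ 0) (hz : z ^ m = aeval x f)
    (hgen : IntermediateField.adjoin K {x, z} = ⊤)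
    (hli : ∀ p : ℕ → K[X], powSum x z m p = 0 → ∀ t < m, p t = 0)
    {g : F} (hg : ∀ P : FnPlace K F, P.v x ≤ 1 → P.v g ≤ 1) :
    ∃ p : ℕ → K[X], g * aeval x f ^ (m - 1) = powSum x z m p := by
  have hmin : minpoly E z = X ^ m - C (algebraMap K[X] E f) := by
    refine minpoly_eq_X_pow_sub_C hm (by rw [hz, hx]) fun p hp => hli p ?_
    simpa only [powSum, hx] using hp
  have hintA : IsIntegral K[X] z := by
    refine ⟨X ^ m - C f, monic_X_pow_sub_C f hm.ne', ?_⟩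
    simp [hx, hz]
  have hint : IsIntegral E z := hintA.tower_top
  have htop : E⟮z⟯ = ⊤ := by
    rw [eq_top_iff]
    intro g _
    have hmem : ∀ p : ℕ → K[X], powSum x z m p ∈ E⟮z⟯ := fun p => by
      refine sum_mem fun t _ => mul_mem ?_ (pow_mem (mem_adjoin_simple_self E z) t)
      rw [← hx, IsScalarTower.algebraMap_apply K[X] E F]
      exact E⟮z⟯.algebraMap_mem _
    obtain ⟨p, q, -, rfl⟩ := exists_eq_powSum_div_powSum hm hz hgen g
    exact div_mem (hmem p) (hmem q)
  have hsep : Algebra.IsSeparable E F := by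
    have hz' : IsSeparable E z := by
      rw [IsSeparable, hmin]
      refine separable_X_pow_sub_C _ ?_ ?_
      · rw [← map_natCast (algebraMap K[X] E), Ne, ← map_zero (algebraMap K[X] E),
          (IsFractionRing.injective K[X] E).eq_iff, ← C_eq_natCast, C_eq_zero]
        exact hmK
      · rwa [Ne, ← map_zero (algebraMap K[X] E), (IsFractionRing.injective K[X] E).eq_iff]
    have h1 := (isSeparable_adjoin_simple_iff_isSeparable E F).2 hz'
    rw [htop] at h1
    exact AlgEquiv.Algebra.isSeparable (topEquiv (F := E) (E := F))
  have hadj : Algebra.adjoin E {z} = ⊤ := by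
    rw [← adjoin_simple_toSubalgebra_of_isAlgebraic hint.isAlgebraic, htop, top_toSubalgebra]
  let B : PowerBasis E F := PowerBasis.ofAdjoinEqTop hint hadj
  have hBgen : B.gen = z := PowerBasis.ofAdjoinEqTop_gen hint hadj
  have : Module.Finite E F := B.finite
  have : IsDedekindDomain (integralClosure K[X] F) := integralClosure.isDedekindDomain K[X] E F
  have : IsFractionRing (integralClosure K[X] F) F :=
    integralClosure.isFractionRing_of_finite_extension E F
  have hgint : IsIntegral K[X] g := by
    have hC : ∀ c : K, algebraMap K F c ∈ (algebraMap (integralClosure K[X] F) F).range := by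
      intro c
      refine ⟨algebraMap K[X] _ (Polynomial.C c), ?_⟩
      rw [← IsScalarTower.algebraMap_apply K[X] (integralClosure K[X] F) F, hx, aeval_C]
    -- An element of `F` lies in the integral closure once its valuations at all maximal ideals are
    -- at most `1`. These valuations are places at which `x`, being integral, is regular.
    obtain ⟨⟨g', hg'⟩, rfl⟩ :=
      IsDedekindDomain.HeightOneSpectrum.mem_integers_of_valuation_le_one
        (R := integralClosure K[X] F) F g fun v => by
          refine hg (FnPlace.ofHeightOneSpectrum hC v) ?_
          have := v.valuation_le_one (K := F) (algebraMap K[X] (integralClosure K[X] F) X)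
          rw [Algebra.cast, ← IsScalarTower.algebraMap_apply K[X] (integralClosure K[X] F) F, hx,
            aeval_X] at this
          exact this
    exact hg'
  obtain ⟨c, hc, hdisc⟩ := exists_discr_eq hm hmK B (hBgen ▸ hmin)
  have hmem := Algebra.discr_mul_isIntegral_mem_adjoin E (B := B) (hBgen ▸ hintA) hgint
  rw [hBgen, hdisc, Algebra.adjoin_singleton_eq_range_aeval, AlgHom.mem_range] at hmem
  obtain ⟨Q, hQ⟩ := hmem
  have hc' : algebraMap K F c ≠ 0 := (_root_.map_ne_zero _).2 hc
  -- The factor `c⁻¹` removes the constant of the discriminant. The degree of `Q` may exceed `m -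
  -- 1`, so powers of `z` are reduced afterwards.
  have key : g * aeval x f ^ (m - 1) =
      powSum x z (Q.natDegree + 1) fun t => C c⁻¹ * Q.coeff t := by
    have h1 : powSum x z (Q.natDegree + 1) (fun t => C c⁻¹ * Q.coeff t) =
        algebraMap K F c⁻¹ * aeval z Q := by
      rw [aeval_eq_sum_range, powSum, Finset.mul_sum]
      refine Finset.sum_congr rfl fun t _ => ?_
      rw [Algebra.smul_def, hx, map_mul, aeval_C, mul_assoc]
    rw [h1, hQ, Algebra.smul_def, ← IsScalarTower.algebraMap_apply K[X] E F, hx, map_mul, aeval_C,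
      map_pow, map_inv₀]
    field_simp
  rw [key]
  exact exists_powSum_eq_powSum hm hz _ _

theorem exists_powSum_eq_mul_pow {x z : F} (hx : Transcendental K x) {m : ℕ} (hm : 0 < m)
    (hmK : (m : K) ≠ 0) {f : K[X]} (hf : f ≠ 0) (hz : z ^ m = aeval x f)
    (hgen : IntermediateField.adjoin K {x, z} = ⊤)
    (hli : ∀ p : ℕ → K[X], powSum x z m p = 0 → ∀ t < m, p t = 0)
    {g : F} (hg : ∀ P : FnPlace K F, P.v x ≤ 1 → P.v g ≤ 1) :
    ∃ p : ℕ → K[X], g * aeval x f ^ (m - 1) = powSum x z m p := by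
  let : Algebra K[X] F := (aeval x).toRingHom.toAlgebra
  have : FaithfulSMul K[X] F :=
    (faithfulSMul_iff_algebraMap_injective _ _).2 (transcendental_iff_injective.1 hx)
  let := FractionRing.liftAlgebra K[X] F
  have : IsScalarTower K[X] (FractionRing K[X]) F := inferInstance
  exact exists_powSum_eq_mul_pow_aux (E := FractionRing K[X]) (fun _ => rfl) hm hmK hf hz hgen
    hli hg

end

/-! ### The Kummer cover and its ramified places. -/

section

open Polynomial FnPlace

variable {K F : Type*} [Field K] [Field F] [Algebra K F] {r : ℕ}

/-- `F = K(x, z)` with `z ^ m = ∏ (x - α_i)`, totally ramified over the `α_i` and over `∞`. -/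
structure IsKummerCover (α : Fin r → K) (x z : F) (m : ℕ) : Prop where
  pos : 0 < m
  cast_ne_zero : (m : K) ≠ 0
  coprime : IsCoprime (r : ℤ) m
  injective : Function.Injective α
  transcendental : Transcendental K x
  pow_eq : z ^ m = ∏ i, (x - algebraMap K F (α i))
  adjoin_eq_top : IntermediateField.adjoin K {x, z} = ⊤

/-- The polynomial `∏ (X - α_i)`. -/
def branchPoly (α : Fin r → K) : K[X] := ∏ i, (X - C (α i))

theorem branchPoly_ne_zero (α : Fin r → K) : branchPoly α ≠ 0 :=
  Finset.prod_ne_zero_iff.2 fun i _ => X_sub_C_ne_zero (α i)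

namespace IsKummerCover

variable {α : Fin r → K} {x z : F} {m : ℕ}

theorem pow_eq_aeval (h : IsKummerCover α x z m) : z ^ m = aeval x (branchPoly α) := by
  simp [h.pow_eq, branchPoly]

theorem x_sub_ne_zero (h : IsKummerCover α x z m) (c : K) : x - algebraMap K F c ≠ 0 := by
  intro h0
  have := transcendental_iff.1 h.transcendental (X - C c) (by simpa using h0)
  exact X_sub_C_ne_zero c this

theorem x_ne_zero (h : IsKummerCover α x z m) : x ≠ 0 := by
  simpa using h.x_sub_ne_zero 0

theorem aeval_branchPoly_ne_zero (h : IsKummerCover α x z m) : aeval x (branchPoly α) ≠ 0 :=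
  fun h0 => branchPoly_ne_zero α (transcendental_iff.1 h.transcendental _ h0)

theorem z_ne_zero (h : IsKummerCover α x z m) : z ≠ 0 := by
  intro h0
  apply h.aeval_branchPoly_ne_zero
  rw [← h.pow_eq_aeval, h0, zero_pow h.pos.ne']

theorem mul_ord_z (h : IsKummerCover α x z m) (P : FnPlace K F) :
    m * P.ord z = ∑ i, P.ord (x - algebraMap K F (α i)) := by
  rw [← P.ord_pow h.z_ne_zero, h.pow_eq, P.ord_prod _ _ fun i _ => h.x_sub_ne_zero (α i)]

theorem exists_eq_powSum_div (h : IsKummerCover α x z m) (g : F) :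
    ∃ p q : ℕ → K[X], powSum x z m q ≠ 0 ∧ g = powSum x z m p / powSum x z m q :=
  exists_eq_powSum_div_powSum h.pos h.pow_eq_aeval h.adjoin_eq_top g

/-- Only one factor of `z ^ m` vanishes at `P`, so `x - α_i` has order `m * P.ord z`. Thus the data
hold with `u = P.ord z`, and `index_eq_one` gives `u = 1`. -/
theorem isTotallyRamified_zero (h : IsKummerCover α x z m) {P : FnPlace K F} {i : Fin r}
    (hP : 0 < P.ord (x - algebraMap K F (α i))) :
    P.IsTotallyRamified x z m (fun p => p.rootMultiplicity (α i)) 1 1 := by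
  have h1 : m * P.ord z = P.ord (x - algebraMap K F (α i)) := by
    rw [h.mul_ord_z, Finset.sum_eq_single i _ (by simp)]
    intro j _ hj
    exact P.ord_sub_algebraMap_of_ord_pos hP (h.x_sub_ne_zero _) (h.injective.ne hj)
  have hram : P.IsTotallyRamified x z m (fun p => p.rootMultiplicity (α i)) 1 (P.ord z) := by
    refine ⟨?_, isCoprime_one_left, fun p hp => ?_, by ring⟩
    · rw [← h1] at hP
      exact pos_of_mul_pos_right hP (by positivity)
    · rw [P.ord_aeval_of_ord_pos hP h.transcendental hp, ← h1]
      ring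
  have hu := hram.index_eq_one h.transcendental h.z_ne_zero h.exists_eq_powSum_div
  rwa [hu] at hram

theorem ord_x_sub_of_ord_neg {P : FnPlace K F} (hP : P.ord x < 0) (c : K) :
    P.ord (x - algebraMap K F c) = P.ord x := by
  have := P.ord_aeval_of_ord_neg hP (X_sub_C_ne_zero c)
  simpa using this

/-- From `m * P.ord z = r * P.ord x` and coprimality, `m` divides `P.ord x`; the common factor is
`-P.ord x / m`. -/
theorem isTotallyRamified_infty (h : IsKummerCover α x z m) {P : FnPlace K F}
    (hP : P.ord x < 0) :
    P.IsTotallyRamified x z m (fun p => -(p.natDegree : ℤ)) (-r) 1 := by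
  have h1 : m * P.ord z = r * P.ord x := by
    rw [h.mul_ord_z, Finset.sum_congr rfl fun i _ => ord_x_sub_of_ord_neg hP (α i)]
    simp
  obtain ⟨e, he⟩ : (m : ℤ) ∣ P.ord x :=
    h.coprime.symm.dvd_of_dvd_mul_left ⟨P.ord z, h1.symm⟩
  have hm : (m : ℤ) ≠ 0 := by exact_mod_cast h.pos.ne'
  have hz : P.ord z = r * e := by
    apply mul_left_cancel₀ hm
    rw [h1, he]
    ring
  have hram : P.IsTotallyRamified x z m (fun p => -(p.natDegree : ℤ)) (-r) (-e) := by
    refine ⟨?_, h.coprime.neg_left, fun p hp => ?_, by rw [hz]; ring⟩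
    · have : (0 : ℤ) < m := by exact_mod_cast h.pos
      rw [he] at hP
      nlinarith
    · rw [P.ord_aeval_of_ord_neg hP hp, he]
      ring
  have hu := hram.index_eq_one h.transcendental h.z_ne_zero h.exists_eq_powSum_div
  rwa [hu] at hram

theorem zero_place_unique (h : IsKummerCover α x z m) {P Q : FnPlace K F} {i : Fin r}
    (hP : 0 < P.ord (x - algebraMap K F (α i))) (hQ : 0 < Q.ord (x - algebraMap K F (α i))) :
    P = Q :=
  (h.isTotallyRamified_zero hP).place_eq (h.isTotallyRamified_zero hQ) h.transcendental
    h.z_ne_zero h.exists_eq_powSum_div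

theorem infty_place_unique (h : IsKummerCover α x z m) {P Q : FnPlace K F}
    (hP : P.ord x < 0) (hQ : Q.ord x < 0) : P = Q :=
  (h.isTotallyRamified_infty hP).place_eq (h.isTotallyRamified_infty hQ) h.transcendental
    h.z_ne_zero h.exists_eq_powSum_div

theorem ord_z_zero (h : IsKummerCover α x z m) {P : FnPlace K F} {i : Fin r}
    (hP : 0 < P.ord (x - algebraMap K F (α i))) : P.ord z = 1 := by
  simpa using (h.isTotallyRamified_zero hP).ord_gen

theorem ord_z_infty (h : IsKummerCover α x z m) {P : FnPlace K F} (hP : P.ord x < 0) :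
    P.ord z = -r := by
  simpa using (h.isTotallyRamified_infty hP).ord_gen

theorem ord_x_sub_zero (h : IsKummerCover α x z m) {P : FnPlace K F} {i : Fin r}
    (hP : 0 < P.ord (x - algebraMap K F (α i))) (j : Fin r) :
    P.ord (x - algebraMap K F (α j)) = if j = i then (m : ℤ) else 0 := by
  have h1 : ∀ j ≠ i, P.ord (x - algebraMap K F (α j)) = 0 := fun j hj =>
    P.ord_sub_algebraMap_of_ord_pos hP (h.x_sub_ne_zero _) (h.injective.ne hj)
  split_ifs with hj
  · have h2 := h.mul_ord_z P
    rw [h.ord_z_zero hP, Finset.sum_eq_single i (fun j _ hj => h1 j hj) (by simp)] at h2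
    rw [hj, ← h2, mul_one]
  · exact h1 j hj

theorem ord_x_infty (h : IsKummerCover α x z m) {P : FnPlace K F} (hP : P.ord x < 0) (c : K) :
    P.ord (x - algebraMap K F c) = -m := by
  rw [ord_x_sub_of_ord_neg hP]
  have := (h.isTotallyRamified_infty hP).ord_aeval X X_ne_zero
  simpa using this

end IsKummerCover

/-! ### Monomials, and expansions of functions with poles only at ramified places. -/

/-- The function `∏ (x - α_i) ^ n_i * z ^ c`. -/
def kummerMonomial (α : Fin r → K) (x z : F) (n : Fin r → ℤ) (c : ℤ) : F :=
  (∏ i, (x - algebraMap K F (α i)) ^ n i) * z ^ c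

namespace IsKummerCover

variable {α : Fin r → K} {x z : F} {m : ℕ}

theorem kummerMonomial_ne_zero (h : IsKummerCover α x z m) (n : Fin r → ℤ) (c : ℤ) :
    kummerMonomial α x z n c ≠ 0 :=
  mul_ne_zero (Finset.prod_ne_zero_iff.2 fun _ _ => zpow_ne_zero _ (h.x_sub_ne_zero _))
    (zpow_ne_zero _ h.z_ne_zero)

theorem ord_kummerMonomial (h : IsKummerCover α x z m) (P : FnPlace K F) (n : Fin r → ℤ)
    (c : ℤ) : P.ord (kummerMonomial α x z n c) =
      ∑ i, n i * P.ord (x - algebraMap K F (α i)) + c * P.ord z := by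
  have h0 : ∀ i ∈ Finset.univ, (x - algebraMap K F (α i)) ^ n i ≠ 0 :=
    fun i _ => zpow_ne_zero _ (h.x_sub_ne_zero _)
  rw [kummerMonomial, P.ord_mul (Finset.prod_ne_zero_iff.2 h0) (zpow_ne_zero _ h.z_ne_zero),
    P.ord_prod _ _ h0, P.ord_zpow h.z_ne_zero]
  simp_rw [P.ord_zpow (h.x_sub_ne_zero _)]

theorem ord_kummerMonomial_zero (h : IsKummerCover α x z m) {P : FnPlace K F} {i : Fin r}
    (hP : 0 < P.ord (x - algebraMap K F (α i))) (n : Fin r → ℤ) (c : ℤ) :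
    P.ord (kummerMonomial α x z n c) = m * n i + c := by
  rw [h.ord_kummerMonomial, h.ord_z_zero hP]
  simp_rw [h.ord_x_sub_zero hP]
  simp [mul_comm]

theorem ord_kummerMonomial_infty (h : IsKummerCover α x z m) {P : FnPlace K F}
    (hP : P.ord x < 0) (n : Fin r → ℤ) (c : ℤ) :
    P.ord (kummerMonomial α x z n c) = -(m * ∑ i, n i) - r * c := by
  rw [h.ord_kummerMonomial, h.ord_z_infty hP]
  simp_rw [h.ord_x_infty hP]
  rw [← Finset.sum_mul]
  ring

theorem ord_kummerMonomial_eq_zero (h : IsKummerCover α x z m) {P : FnPlace K F}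
    (hP : 0 ≤ P.ord x) (hP' : ∀ i, P.ord (x - algebraMap K F (α i)) ≤ 0) (n : Fin r → ℤ)
    (c : ℤ) : P.ord (kummerMonomial α x z n c) = 0 := by
  have h0 : ∀ i, P.ord (x - algebraMap K F (α i)) = 0 := fun i => by
    refine le_antisymm (hP' i) ?_
    have := P.v_aeval_le_one h.x_ne_zero hP (X - C (α i))
    rw [← P.v.map_one, P.v_le_v_iff (by simpa using h.x_sub_ne_zero (α i)) one_ne_zero] at this
    simpa using this
  have hz := h.mul_ord_z P
  simp only [h0, Finset.sum_const_zero, mul_eq_zero, Int.natCast_eq_zero, h.pos.ne',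
    false_or] at hz
  rw [h.ord_kummerMonomial, hz]
  simp [h0]

theorem ord_branchPoly_zero (h : IsKummerCover α x z m) {P : FnPlace K F} {i : Fin r}
    (hP : 0 < P.ord (x - algebraMap K F (α i))) : P.ord (aeval x (branchPoly α)) = m := by
  rw [← h.pow_eq_aeval, P.ord_pow h.z_ne_zero, h.ord_z_zero hP, mul_one]

theorem ord_branchPoly_infty (h : IsKummerCover α x z m) {P : FnPlace K F}
    (hP : P.ord x < 0) : P.ord (aeval x (branchPoly α)) = -(r * m) := by
  rw [← h.pow_eq_aeval, P.ord_pow h.z_ne_zero, h.ord_z_infty hP]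
  ring

variable {P : Fin r → FnPlace K F} {Pinf : FnPlace K F}

theorem eq_zero_of_powSum_eq_zero (h : IsKummerCover α x z m) (hPinf : Pinf.ord x < 0)
    (p : ℕ → K[X]) (hp : powSum x z m p = 0) : ∀ t < m, p t = 0 :=
  (h.isTotallyRamified_infty hPinf).eq_zero_of_powSum_eq_zero h.transcendental h.z_ne_zero p hp

/-- The first `M` factors of the branch polynomial, each of order `m ≥ 1` at every `P i`, clear the
poles there; the other `m - 1` are the discriminant. -/
theorem exists_mul_branchPoly_pow_eq (h : IsKummerCover α x z m)
    (hP : ∀ i, 0 < (P i).ord (x - algebraMap K F (α i))) (hPinf : Pinf.ord x < 0)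
    {f : F} (hf : f ≠ 0)
    (hreg : ∀ Q : FnPlace K F, (∀ i, Q ≠ P i) → Q ≠ Pinf → 0 ≤ Q.ord f) {M : ℕ}
    (hM : ∀ i, -(M : ℤ) ≤ (P i).ord f) :
    ∃ p : ℕ → K[X], f * aeval x (branchPoly α) ^ (M + (m - 1)) = powSum x z m p := by
  rw [pow_add, ← mul_assoc]
  refine exists_powSum_eq_mul_pow h.transcendental h.pos h.cast_ne_zero (branchPoly_ne_zero α)
    h.pow_eq_aeval h.adjoin_eq_top (h.eq_zero_of_powSum_eq_zero hPinf) fun Q hQ => ?_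
  have hb := h.aeval_branchPoly_ne_zero
  rw [← Q.v.map_one, Q.v_le_v_iff h.x_ne_zero one_ne_zero, ord_one] at hQ
  rw [← Q.v.map_one, Q.v_le_v_iff (mul_ne_zero hf (pow_ne_zero _ hb)) one_ne_zero, ord_one,
    Q.ord_mul hf (pow_ne_zero _ hb), Q.ord_pow hb]
  by_cases hQP : ∃ i, Q = P i
  · obtain ⟨i, rfl⟩ := hQP
    rw [h.ord_branchPoly_zero (hP i)]
    have h1 := hM i
    have h2 : (M : ℤ) * 1 ≤ M * m :=
      mul_le_mul_of_nonneg_left (by exact_mod_cast h.pos) (by positivity)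
    omega
  · push Not at hQP
    have h1 := hreg Q hQP fun h0 => by
      rw [h0] at hQ
      omega
    have h2 := Q.v_aeval_le_one h.x_ne_zero hQ (branchPoly α)
    rw [← Q.v.map_one, Q.v_le_v_iff hb one_ne_zero, ord_one] at h2
    positivity

theorem sum_rootMultiplicity_le (h : IsKummerCover α x z m) (p : K[X]) :
    ∑ i, (p.rootMultiplicity (α i) : ℤ) ≤ p.natDegree := by
  classical
  have h1 : ∑ i, p.rootMultiplicity (α i) = ∑ a ∈ Finset.univ.image α, p.roots.count a := by
    rw [Finset.sum_image fun i _ j _ hij => h.injective hij]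
    simp
  have h2 := Multiset.sum_count_eq_card (s := Finset.univ.image α)
    (m := p.roots.filter (· ∈ Finset.univ.image α)) fun a ha => (Multiset.mem_filter.1 ha).2
  have h3 : ∑ i, p.rootMultiplicity (α i) ≤ p.natDegree := by
    rw [h1, ← Finset.sum_congr rfl fun a ha => Multiset.count_filter_of_pos ha, h2]
    exact (Multiset.card_le_card (Multiset.filter_le _ _)).trans (card_roots' p)
  exact_mod_cast h3

/-- The orders at the places `P_i` and `P_∞` of a term of the expansion of `f` in powers of `z`. -/
theorem ord_le_of_mul_branchPoly_pow_eq (h : IsKummerCover α x z m)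
    (hP : ∀ i, 0 < (P i).ord (x - algebraMap K F (α i))) (hPinf : Pinf.ord x < 0)
    {f : F} (hf : f ≠ 0) {N : ℕ} {p : ℕ → K[X]}
    (hp : f * aeval x (branchPoly α) ^ N = powSum x z m p) :
    (∀ t < m, p t ≠ 0 →
      (∀ i, (P i).ord f ≤ m * (p t).rootMultiplicity (α i) + (t - m * N)) ∧
        Pinf.ord f ≤ -(m * (p t).natDegree) - r * (t - m * N)) ∧
    (∀ i, ∃ t < m, p t ≠ 0 ∧
      (P i).ord f = m * (p t).rootMultiplicity (α i) + (t - m * N)) ∧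
    ∃ t < m, p t ≠ 0 ∧ Pinf.ord f = -(m * (p t).natDegree) - r * (t - m * N) := by
  have hb := h.aeval_branchPoly_ne_zero
  have hne : powSum x z m p ≠ 0 := hp ▸ mul_ne_zero hf (pow_ne_zero _ hb)
  have hex := IsTotallyRamified.exists_of_powSum_ne_zero hne
  have hord : ∀ i, (P i).ord (powSum x z m p) = (P i).ord f + N * m := fun i => by
    rw [← hp, (P i).ord_mul hf (pow_ne_zero _ hb), (P i).ord_pow hb,
      h.ord_branchPoly_zero (hP i)]
  have hordinf : Pinf.ord (powSum x z m p) = Pinf.ord f + N * -(r * m) := by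
    rw [← hp, Pinf.ord_mul hf (pow_ne_zero _ hb), Pinf.ord_pow hb, h.ord_branchPoly_infty hPinf]
  have hz := fun i => (h.isTotallyRamified_zero (hP i)).exists_ord_powSum h.transcendental
    h.z_ne_zero p hex
  obtain ⟨-, t₀, ht₀, hpt₀, hinf1, hinf2⟩ :=
    (h.isTotallyRamified_infty hPinf).exists_ord_powSum h.transcendental h.z_ne_zero p hex
  refine ⟨fun t ht hpt => ⟨fun i => ?_, ?_⟩, fun i => ?_, t₀, ht₀, hpt₀, ?_⟩
  · obtain ⟨-, -, -, -, -, h2⟩ := hz i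
    have := h2 t ht hpt
    rw [hord] at this
    linarith
  · have := hinf2 t ht hpt
    rw [hordinf] at this
    linarith
  · obtain ⟨-, t, ht, hpt, h2, -⟩ := hz i
    refine ⟨t, ht, hpt, ?_⟩
    rw [hord] at h2
    linarith
  · rw [hordinf] at hinf1
    linarith

theorem exists_natCast_le_ord (P : Fin r → FnPlace K F) (f : F) :
    ∃ M : ℕ, ∀ i, -(M : ℤ) ≤ (P i).ord f := by
  refine ⟨∑ i, ((P i).ord f).natAbs, fun i => ?_⟩
  have := Finset.single_le_sum (f := fun i => ((P i).ord f).natAbs) (fun _ _ => Nat.zero_le _)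
    (Finset.mem_univ i)
  omega

/-- A function regular outside the `P_i` and `P_∞` has a term `h(x) z ^ c`, regular there too, with
no smaller orders at these places and the same order at `P_i₀`. -/
theorem exists_exponents_zero (h : IsKummerCover α x z m)
    (hP : ∀ i, 0 < (P i).ord (x - algebraMap K F (α i))) (hPinf : Pinf.ord x < 0)
    {f : F} (hf : f ≠ 0)
    (hreg : ∀ Q : FnPlace K F, (∀ i, Q ≠ P i) → Q ≠ Pinf → 0 ≤ Q.ord f) (i₀ : Fin r) :
    ∃ (n : Fin r → ℤ) (c d : ℤ), ∑ i, n i ≤ d ∧ (∀ i, (P i).ord f ≤ m * n i + c) ∧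
      Pinf.ord f ≤ -(m * d) - r * c ∧ (P i₀).ord f = m * n i₀ + c := by
  obtain ⟨M, hM⟩ := exists_natCast_le_ord P f
  obtain ⟨p, hp⟩ := h.exists_mul_branchPoly_pow_eq hP hPinf hf hreg hM
  obtain ⟨h1, h2, -⟩ := h.ord_le_of_mul_branchPoly_pow_eq hP hPinf hf hp
  obtain ⟨t, ht, hpt, h3⟩ := h2 i₀
  -- Here `n i` is the multiplicity of `α i` in `p t`, `d` is the degree of `p t`, and `c = t - m *
  -- N` with `N` the exponent of the branch polynomial. Roots of `p t` other than the `α i` can make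
  -- `d` exceed the sum of the `n i`.
  exact ⟨_, _, _, h.sum_rootMultiplicity_le _, (h1 t ht hpt).1, (h1 t ht hpt).2, h3⟩

theorem exists_exponents_infty (h : IsKummerCover α x z m)
    (hP : ∀ i, 0 < (P i).ord (x - algebraMap K F (α i))) (hPinf : Pinf.ord x < 0)
    {f : F} (hf : f ≠ 0)
    (hreg : ∀ Q : FnPlace K F, (∀ i, Q ≠ P i) → Q ≠ Pinf → 0 ≤ Q.ord f) :
    ∃ (n : Fin r → ℤ) (c d : ℤ), ∑ i, n i ≤ d ∧ (∀ i, (P i).ord f ≤ m * n i + c) ∧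
      Pinf.ord f = -(m * d) - r * c := by
  obtain ⟨M, hM⟩ := exists_natCast_le_ord P f
  obtain ⟨p, hp⟩ := h.exists_mul_branchPoly_pow_eq hP hPinf hf hreg hM
  obtain ⟨h1, -, t, ht, hpt, h3⟩ := h.ord_le_of_mul_branchPoly_pow_eq hP hPinf hf hp
  exact ⟨_, _, _, h.sum_rootMultiplicity_le _, (h1 t ht hpt).1, h3⟩

/-- Riemann-Roch spaces of divisors supported on the `P_i` and `P_∞` are finite-dimensional. -/
theorem finiteDimensional_riemannRochSpace [Finite K] (h : IsKummerCover α x z m)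
    (hP : ∀ i, 0 < (P i).ord (x - algebraMap K F (α i))) (hPinf : Pinf.ord x < 0)
    (G : FnDivisor K F) (hG : ∀ Q : FnPlace K F, (∀ i, Q ≠ P i) → Q ≠ Pinf → G Q = 0) :
    FiniteDimensional K (riemannRochSpace G) := by
  set M : ℕ := ∑ i, (G (P i)).natAbs
  have hM : ∀ i, G (P i) ≤ M := fun i => by
    have := Finset.single_le_sum (f := fun i => (G (P i)).natAbs) (fun _ _ => Nat.zero_le _)
      (Finset.mem_univ i)
    omega
  set N := M + (m - 1)
  -- The order condition at `P_∞` bounds the degree of each coefficient by `D`. Over a finite field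
  -- this leaves finitely many expansions, so the space is a finite set.
  set D := (G Pinf).natAbs + r * (m * N)
  have hb := h.aeval_branchPoly_ne_zero
  have hfin : Finite (degreeLT K (D + 1)) := Finite.of_equiv _ (degreeLTEquiv K (D + 1)).symm.toEquiv
  let Φ : (Fin m → degreeLT K (D + 1)) → F := fun p =>
    (∑ t, aeval x (p t : K[X]) * z ^ (t : ℕ)) / aeval x (branchPoly α) ^ N
  have hsub : (riemannRochSpace G : Set F) ⊆ Set.range Φ := by
    intro f hf
    rcases eq_or_ne f 0 with rfl | hf0
    · exact ⟨0, by simp [Φ]⟩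
    have hf' := hf hf0
    obtain ⟨p, hp⟩ := h.exists_mul_branchPoly_pow_eq hP hPinf hf0
      (fun Q hQ hQ' => by simpa [hG Q hQ hQ'] using hf' Q) (M := M) fun i => by
        have h1 := hf' (P i)
        have h2 := hM i
        omega
    obtain ⟨h1, -⟩ := h.ord_le_of_mul_branchPoly_pow_eq hP hPinf hf0 hp
    have hdeg : ∀ t : Fin m, p t ∈ degreeLT K (D + 1) := fun t => by
      rcases eq_or_ne (p t) 0 with h0 | h0
      · rw [h0]
        exact zero_mem _
      rw [mem_degreeLT, degree_eq_natDegree h0, Nat.cast_lt, Nat.lt_succ_iff]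
      have h2 := (h1 t t.2 h0).2
      have h3 := hf' Pinf
      have h4 : (1 : ℤ) * (p t).natDegree ≤ m * (p t).natDegree :=
        mul_le_mul_of_nonneg_right (by exact_mod_cast h.pos) (by positivity)
      have h5 : (0 : ℤ) ≤ r * (t : ℕ) := by positivity
      have h6 : G Pinf ≤ (G Pinf).natAbs := Int.le_natAbs
      have : ((p t).natDegree : ℤ) ≤ (G Pinf).natAbs + r * (m * N) := by
        rw [mul_sub] at h2
        linarith
      exact_mod_cast this
    refine ⟨fun t => ⟨p t, hdeg t⟩, ?_⟩
    simp only [Φ]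
    rw [div_eq_iff (pow_ne_zero _ hb), hp, powSum, Finset.sum_range]
  have : Finite (riemannRochSpace G) := ((Set.finite_range Φ).subset hsub).to_subtype
  exact Module.Finite.of_finite

end IsKummerCover

end

/-! ### Attained orders, pure gaps and the Weierstrass semigroup. -/

section

open FnPlace

variable {K F : Type*} [Field K] [Field F] [Algebra K F]

/-- Some function in `𝓛(G)` has exact order `-G(Q)` at `Q`. -/
def AttainsAt (G : FnDivisor K F) (Q : FnPlace K F) : Prop :=
  ∃ f ∈ riemannRochSpace G, f ≠ 0 ∧ Q.ord f = -G Q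

/-- The smaller space is contained in the larger, so in finite dimension equal dimensions mean equal
spaces. -/
theorem ell_eq_ell_sub_single_iff (G : FnDivisor K F) (Q : FnPlace K F)
    [FiniteDimensional K (riemannRochSpace G)] :
    ell G = ell (G - Finsupp.single Q 1) ↔ ¬AttainsAt G Q := by
  have hle : riemannRochSpace (G - Finsupp.single Q 1) ≤ riemannRochSpace G := by
    intro f hf hf0 R
    have h1 := hf hf0 R
    have h2 : (0 : ℤ) ≤ Finsupp.single Q (1 : ℤ) R := by
      classical
      rw [Finsupp.single_apply]
      split_ifs <;> norm_num
    rw [Finsupp.sub_apply] at h1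
    omega
  constructor
  · rintro h ⟨f, hf, hf0, hord⟩
    rw [← Submodule.eq_of_le_of_finrank_eq hle h.symm] at hf
    have := hf hf0 Q
    rw [Finsupp.sub_apply, Finsupp.single_eq_same] at this
    omega
  · intro h
    have hge : riemannRochSpace G ≤ riemannRochSpace (G - Finsupp.single Q 1) := by
      intro f hf hf0 R
      have h1 := hf hf0 R
      rw [Finsupp.sub_apply]
      by_cases hR : R = Q
      · subst hR
        have : R.ord f ≠ -G R := fun h0 => h ⟨f, hf, hf0, h0⟩
        rw [Finsupp.single_eq_same]
        omega
      · rw [Finsupp.single_eq_of_ne hR]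
        omega
    rw [ell, ell, le_antisymm hge hle]

theorem sumDivisor_pair (Q₁ Q₂ : FnPlace K F) (s : Fin 2 → ℕ) :
    sumDivisor ![Q₁, Q₂] s = Finsupp.single Q₁ (s 0 : ℤ) + Finsupp.single Q₂ (s 1 : ℤ) := by
  simp [sumDivisor, Fin.sum_univ_two]

theorem mem_pureGapSet_pair_iff (Q₁ Q₂ : FnPlace K F) (s : Fin 2 → ℕ)
    [FiniteDimensional K (riemannRochSpace (sumDivisor ![Q₁, Q₂] s))] :
    s ∈ pureGapSet ![Q₁, Q₂] ↔ (0 < s 0 ∧ 0 < s 1) ∧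
      ¬AttainsAt (sumDivisor ![Q₁, Q₂] s) Q₁ ∧ ¬AttainsAt (sumDivisor ![Q₁, Q₂] s) Q₂ := by
  simp [pureGapSet, Fin.forall_fin_two, ell_eq_ell_sub_single_iff]

theorem mem_weierstrassSemigroup_pair_iff {Q₁ Q₂ : FnPlace K F} (hQ : Q₁ ≠ Q₂) (s : Fin 2 → ℕ) :
    s ∈ weierstrassSemigroup ![Q₁, Q₂] ↔
      AttainsAt (sumDivisor ![Q₁, Q₂] s) Q₁ ∧ AttainsAt (sumDivisor ![Q₁, Q₂] s) Q₂ := by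
  set G := sumDivisor ![Q₁, Q₂] s with hG
  have hG1 : G Q₁ = s 0 := by
    rw [hG, sumDivisor_pair, Finsupp.add_apply, Finsupp.single_eq_same,
      Finsupp.single_eq_of_ne hQ, add_zero]
  have hG2 : G Q₂ = s 1 := by
    rw [hG, sumDivisor_pair, Finsupp.add_apply, Finsupp.single_eq_same,
      Finsupp.single_eq_of_ne hQ.symm, zero_add]
  have hG3 : ∀ R, R ≠ Q₁ → R ≠ Q₂ → G R = 0 := fun R h1 h2 => by
    rw [hG, sumDivisor_pair, Finsupp.add_apply, Finsupp.single_eq_of_ne h1,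
      Finsupp.single_eq_of_ne h2, zero_add]
  have hG0 : ∀ R, 0 ≤ G R := fun R => by
    by_cases h1 : R = Q₁
    · rw [h1, hG1]; positivity
    by_cases h2 : R = Q₂
    · rw [h2, hG2]; positivity
    rw [hG3 R h1 h2]
  constructor
  · rintro ⟨f, hf0, hf⟩
    have hval : ∀ R, max 0 (-R.ord f) = G R := fun R => congrFun hf R
    have hmem : f ∈ riemannRochSpace G := fun _ R => by
      have := hval R
      omega
    have h1mem : (1 : F) ∈ riemannRochSpace G := fun _ R => by
      rw [ord_one, zero_add]
      exact hG0 R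
    have key : ∀ R, AttainsAt G R := fun R => by
      have := hval R
      rcases (hG0 R).eq_or_lt with h0 | h0
      -- Where the coefficient is `0`, `f` may have a zero, but the constant `1` has order exactly
      -- `0`.
      · exact ⟨1, h1mem, one_ne_zero, by rw [ord_one, ← h0, neg_zero]⟩
      · exact ⟨f, hmem, hf0, by omega⟩
    exact ⟨key Q₁, key Q₂⟩
  · rintro ⟨⟨f, hf, hf0, hf1⟩, g, hg, hg0, hg2⟩
    have key : ∀ e ∈ riemannRochSpace G, e ≠ 0 → Q₁.ord e = -G Q₁ → Q₂.ord e = -G Q₂ →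
        s ∈ weierstrassSemigroup ![Q₁, Q₂] := by
      intro e he he0 h1 h2
      refine ⟨e, he0, funext fun R => ?_⟩
      change max 0 (-R.ord e) = G R
      have h3 := hG0 R
      by_cases hR1 : R = Q₁
      · rw [hR1] at h3 ⊢
        omega
      by_cases hR2 : R = Q₂
      · rw [hR2] at h3 ⊢
        omega
      have h4 := he he0 R
      have h5 := hG3 R hR1 hR2
      omega
    have hf2 := hf hf0 Q₂
    have hg1 := hg hg0 Q₁
    by_cases h1 : Q₂.ord f = -G Q₂
    · exact key f hf hf0 hf1 h1
    by_cases h2 : Q₁.ord g = -G Q₁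
    · exact key g hg hg0 h2 hg2
    -- If neither function attains both orders, each is strictly dominated by the other at one
    -- place, so the sum attains both.
    have h3 : Q₁.ord (f + g) = -G Q₁ := by
      rw [Q₁.ord_add_of_lt hf0 hg0 (by omega), hf1]
    have h4 : Q₂.ord (f + g) = -G Q₂ := by
      rw [add_comm, Q₂.ord_add_of_lt hg0 hf0 (by omega), hg2]
    refine key _ (add_mem hf hg) (fun h0 => ?_) h3 h4
    rw [add_eq_zero_iff_eq_neg] at h0
    rw [h0, Q₁.ord_neg] at hf1
    exact h2 hf1

namespace IsKummerCover

variable {r : ℕ} {α : Fin r → K} {x z : F} {m : ℕ} {P : Fin r → FnPlace K F}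
  {Pinf : FnPlace K F}

theorem zero_ne_infty (h : IsKummerCover α x z m)
    (hP : ∀ i, 0 < (P i).ord (x - algebraMap K F (α i))) (hPinf : Pinf.ord x < 0) (i : Fin r) :
    P i ≠ Pinf := by
  intro h0
  have h1 := hP i
  rw [h0, h.ord_x_infty hPinf] at h1
  omega

theorem places_injective (h : IsKummerCover α x z m)
    (hP : ∀ i, 0 < (P i).ord (x - algebraMap K F (α i))) : Function.Injective P := by
  intro i j hij
  by_contra hne
  have h1 := hP i
  rw [hij, h.ord_x_sub_zero (hP j), if_neg hne] at h1
  exact lt_irrefl _ h1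

theorem kummerMonomial_mem (h : IsKummerCover α x z m)
    (hP : ∀ i, 0 < (P i).ord (x - algebraMap K F (α i))) (hPinf : Pinf.ord x < 0)
    {G : FnDivisor K F} (hG : ∀ Q : FnPlace K F, (∀ i, Q ≠ P i) → Q ≠ Pinf → G Q = 0)
    {n : Fin r → ℤ} {c : ℤ} (h0 : ∀ i, -G (P i) ≤ m * n i + c)
    (hinf : m * ∑ i, n i + r * c ≤ G Pinf) :
    kummerMonomial α x z n c ∈ riemannRochSpace G := by
  intro _ Q
  by_cases hQ : ∃ i, Q = P i
  · obtain ⟨i, rfl⟩ := hQ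
    rw [h.ord_kummerMonomial_zero (hP i)]
    linarith [h0 i]
  push Not at hQ
  by_cases hQ' : Q = Pinf
  · subst hQ'
    rw [h.ord_kummerMonomial_infty hPinf]
    linarith
  rw [hG Q hQ hQ', h.ord_kummerMonomial_eq_zero, add_zero]
  · exact not_lt.1 fun h1 => hQ' (h.infty_place_unique h1 hPinf)
  · exact fun i => not_lt.1 fun h1 => hQ i (h.zero_place_unique h1 (hP i))

/-- Dropping the roots of `p_t` other than the `α i` keeps the orders at the `P i` and can only
weaken the pole at `P_∞`. -/
theorem attainsAt_zero_iff (h : IsKummerCover α x z m)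
    (hP : ∀ i, 0 < (P i).ord (x - algebraMap K F (α i))) (hPinf : Pinf.ord x < 0)
    {G : FnDivisor K F} (hG : ∀ Q : FnPlace K F, (∀ i, Q ≠ P i) → Q ≠ Pinf → G Q = 0)
    (i₀ : Fin r) : AttainsAt G (P i₀) ↔ ∃ (n : Fin r → ℤ) (c : ℤ),
      (∀ i, -G (P i) ≤ m * n i + c) ∧ m * ∑ i, n i + r * c ≤ G Pinf ∧
        m * n i₀ + c = -G (P i₀) := by
  constructor
  · rintro ⟨f, hf, hf0, hord⟩
    have hf' := hf hf0
    obtain ⟨n, c, d, hnd, h1, h2, h3⟩ := h.exists_exponents_zero hP hPinf hf0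
      (fun Q hQ hQ' => by simpa [hG Q hQ hQ'] using hf' Q) i₀
    refine ⟨n, c, fun i => ?_, ?_, by rw [← h3, hord]⟩
    · linarith [h1 i, hf' (P i)]
    · have : (m : ℤ) * ∑ i, n i ≤ m * d := mul_le_mul_of_nonneg_left hnd (by positivity)
      linarith [hf' Pinf]
  · rintro ⟨n, c, h1, h2, h3⟩
    exact ⟨_, h.kummerMonomial_mem hP hPinf hG h1 h2, h.kummerMonomial_ne_zero n c,
      by rw [h.ord_kummerMonomial_zero (hP i₀), h3]⟩

theorem attainsAt_infty_iff (h : IsKummerCover α x z m)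
    (hP : ∀ i, 0 < (P i).ord (x - algebraMap K F (α i))) (hPinf : Pinf.ord x < 0)
    {G : FnDivisor K F} (hG : ∀ Q : FnPlace K F, (∀ i, Q ≠ P i) → Q ≠ Pinf → G Q = 0)
    (i₀ : Fin r) : AttainsAt G Pinf ↔ ∃ (n : Fin r → ℤ) (c : ℤ),
      (∀ i, -G (P i) ≤ m * n i + c) ∧ m * ∑ i, n i + r * c = G Pinf := by
  constructor
  · rintro ⟨f, hf, hf0, hord⟩
    have hf' := hf hf0
    obtain ⟨n, c, d, hnd, h1, h2⟩ := h.exists_exponents_infty hP hPinf hf0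
      (fun Q hQ hQ' => by simpa [hG Q hQ hQ'] using hf' Q)
    -- The order at `P_∞` must be kept exactly, so the missing degree goes to the factor at `i₀`,
    -- where it only raises the order.
    refine ⟨n + Pi.single i₀ (d - ∑ i, n i), c, fun i => ?_, ?_⟩
    · have h3 : (0 : ℤ) ≤ (Pi.single i₀ (d - ∑ i, n i) : Fin r → ℤ) i := by
        by_cases hi : i = i₀
        · subst hi
          simpa using hnd
        · simp [hi]
      have h4 : (0 : ℤ) ≤ m * (Pi.single i₀ (d - ∑ i, n i) : Fin r → ℤ) i := by positivity
      rw [Pi.add_apply, mul_add]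
      linarith [h1 i, hf' (P i)]
    · have h5 : ∑ i, (n + Pi.single i₀ (d - ∑ i, n i) : Fin r → ℤ) i = d := by
        simp [Finset.sum_add_distrib]
      rw [h5]
      linarith
  · rintro ⟨n, c, h1, h2⟩
    refine ⟨_, h.kummerMonomial_mem hP hPinf hG h1 h2.le, h.kummerMonomial_ne_zero n c, ?_⟩
    rw [h.ord_kummerMonomial_infty hPinf]
    linarith

end IsKummerCover

/-! ### Solving the integer inequalities by ceilings. -/

theorem ceil_intCast_div_le_iff {m : ℕ} (hm : 0 < m) (a n : ℤ) :
    ⌈(a : ℚ) / (m : ℚ)⌉ ≤ n ↔ a ≤ m * n := by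
  rw [Int.ceil_le, div_le_iff₀ (by exact_mod_cast hm), mul_comm]
  exact_mod_cast Iff.rfl

theorem sum_ite_eq_else_const {r : ℕ} (i : Fin r) (u C : ℤ) :
    ∑ t, (if t = i then u else C) = u + (r - 1) * C := by
  have : ∀ t : Fin r, (if t = i then u else C) = C + if t = i then u - C else 0 := fun t => by
    split_ifs <;> ring
  simp only [this, Finset.sum_add_distrib, Finset.sum_ite_eq', Finset.sum_const, Finset.card_univ,
    Fintype.card_fin, Finset.mem_univ, if_true, nsmul_eq_mul]
  ring

theorem sum_ite_eq_ite_eq_else_const {r : ℕ} {i j : Fin r} (hij : i ≠ j) (u v C : ℤ) :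
    ∑ t, (if t = i then u else if t = j then v else C) = u + v + (r - 2) * C := by
  have : ∀ t : Fin r, (if t = i then u else if t = j then v else C) =
      (if t = i then u else C) + if t = j then v - C else 0 := fun t => by
    by_cases h1 : t = i
    · simp [h1, hij]
    · simp only [h1, if_false]
      split_ifs <;> ring
  simp only [this, Finset.sum_add_distrib, sum_ite_eq_else_const, Finset.sum_ite_eq',
    Finset.mem_univ, if_true]
  ring

/-- The exponents that occur at a zero `P_i` for the divisor `k P_i + l P_j`. -/
theorem exists_exponents_zero_zero_iff {m r : ℕ} (hm : 0 < m) {i j : Fin r} (hij : i ≠ j)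
    (k l : ℤ) :
    (∃ (n : Fin r → ℤ) (c : ℤ),
      (∀ t, -((if t = i then k else 0) + if t = j then l else 0) ≤ m * n t + c) ∧
        m * ∑ t, n t + r * c ≤ 0 ∧ m * n i + c = -k) ↔
    (m : ℤ) * ⌈((k - l : ℤ) : ℚ) / (m : ℚ)⌉ + (m : ℤ) * ((r : ℤ) - 2) * ⌈(k : ℚ) / (m : ℚ)⌉ ≤
      k * r := by
  set A := ⌈((k - l : ℤ) : ℚ) / (m : ℚ)⌉ with hA
  set B := ⌈(k : ℚ) / (m : ℚ)⌉ with hB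
  have hA' := (ceil_intCast_div_le_iff hm (k - l) A).1 le_rfl
  have hB' := (ceil_intCast_div_le_iff hm k B).1 le_rfl
  constructor
  · rintro ⟨n, c, h1, h2, h3⟩
    -- Subtracting the equality at `i` from the inequality at `j` eliminates `c`.
    have hnj : A ≤ n j - n i := by
      rw [hA, ceil_intCast_div_le_iff hm]
      have := h1 j
      rw [if_neg hij.symm, if_pos rfl] at this
      linarith
    have hnt : ∀ t, (if t = i then n i else if t = j then A + n i else B + n i) ≤ n t := by
      intro t
      split_ifs with hti htj
      · rw [hti]
      · rw [htj]
        linarith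
      · have : B ≤ n t - n i := by
          rw [hB, ceil_intCast_div_le_iff hm]
          have := h1 t
          rw [if_neg hti, if_neg htj] at this
          linarith
        linarith
    have hsum := Finset.sum_le_sum fun t (_ : t ∈ Finset.univ) => hnt t
    rw [sum_ite_eq_ite_eq_else_const hij] at hsum
    have hmul := mul_le_mul_of_nonneg_left hsum (Int.natCast_nonneg m)
    have : c = -k - m * n i := by linarith
    subst this
    linarith
  · intro h
    -- As `z ^ m` is the product of all `x - α_t`, adding `1` to every exponent and subtracting `m`
    -- from `c` changes nothing. So `n i = 0` may be assumed, which forces `c = -k`; the other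
    -- exponents are the least possible.
    refine ⟨fun t => if t = i then 0 else if t = j then A else B, -k, fun t => ?_, ?_, ?_⟩
    · by_cases hti : t = i
      · simp [hti, hij]
      · by_cases htj : t = j
        · simp only [htj, hij.symm, if_true, if_false]
          linarith
        · simp only [hti, htj, if_false]
          linarith
    · rw [sum_ite_eq_ite_eq_else_const hij]
      linarith
    · simp

/-- The exponents that occur at a zero `P_i` for the divisor `k P_i + T P_∞`. -/
theorem exists_exponents_zero_infty_iff {m r : ℕ} (hm : 0 < m) (i : Fin r) (k T : ℤ) :
    (∃ (n : Fin r → ℤ) (c : ℤ), (∀ t, -(if t = i then k else 0) ≤ m * n t + c) ∧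
        m * ∑ t, n t + r * c ≤ T ∧ m * n i + c = -k) ↔
    (m : ℤ) * ((r : ℤ) - 1) * ⌈(k : ℚ) / (m : ℚ)⌉ ≤ T + k * r := by
  set B := ⌈(k : ℚ) / (m : ℚ)⌉ with hB
  have hB' := (ceil_intCast_div_le_iff hm k B).1 le_rfl
  constructor
  · rintro ⟨n, c, h1, h2, h3⟩
    have hnt : ∀ t, (if t = i then n i else B + n i) ≤ n t := by
      intro t
      split_ifs with hti
      · rw [hti]
      · have : B ≤ n t - n i := by
          rw [hB, ceil_intCast_div_le_iff hm]
          have := h1 t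
          rw [if_neg hti] at this
          linarith
        linarith
    have hsum := Finset.sum_le_sum fun t (_ : t ∈ Finset.univ) => hnt t
    rw [sum_ite_eq_else_const] at hsum
    have hmul := mul_le_mul_of_nonneg_left hsum (Int.natCast_nonneg m)
    have : c = -k - m * n i := by linarith
    subst this
    linarith
  · intro h
    refine ⟨fun t => if t = i then 0 else B, -k, fun t => ?_, ?_, ?_⟩
    · by_cases hti : t = i
      · simp [hti]
      · simp only [hti, if_false]
        linarith
    · rw [sum_ite_eq_else_const]
      linarith
    · simp

/-- The exponents that occur at `P_∞` for the divisor `k P_i + T P_∞`. -/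
theorem exists_exponents_infty_iff {m r : ℕ} (hm : 0 < m) (i : Fin r) (k T : ℤ) {a b : ℤ}
    (hab : a * r + b * m = 1) :
    (∃ (n : Fin r → ℤ) (c : ℤ), (∀ t, -(if t = i then k else 0) ≤ m * n t + c) ∧
        m * ∑ t, n t + r * c = T) ↔
    (m : ℤ) * ((r : ℤ) - 1) * ⌈((-(a * T) : ℤ) : ℚ) / (m : ℚ)⌉ ≤ k + (a + b * m) * T := by
  set E := ⌈((-(a * T) : ℤ) : ℚ) / (m : ℚ)⌉ with hE
  have hE' := (ceil_intCast_div_le_iff hm (-(a * T)) E).1 le_rfl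
  constructor
  · rintro ⟨n, c, h1, rfl⟩
    set d := ∑ t, n t with hd
    have hnt : ∀ t, (if t = i then n i else E - (b * c - a * d)) ≤ n t := by
      intro t
      split_ifs with hti
      · rw [hti]
      · have : E ≤ n t + (b * c - a * d) := by
          rw [hE, ceil_intCast_div_le_iff hm]
          have := h1 t
          rw [if_neg hti] at this
          -- Bezout gives `c = a * T + m * (b * c - a * d)`, so shifting every exponent by `b * c -
          -- a * d` normalizes `c` to `a * T`.
          have hc : a * (m * d + r * c) = c - m * (b * c - a * d) := by
            linear_combination c * hab
          rw [hc]
          linarith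
        linarith
    have hsum := Finset.sum_le_sum fun t (_ : t ∈ Finset.univ) => hnt t
    rw [sum_ite_eq_else_const, ← hd] at hsum
    have hmul := mul_le_mul_of_nonneg_left hsum (Int.natCast_nonneg m)
    have hi := h1 i
    rw [if_pos rfl] at hi
    have hid : (a + b * m) * (m * d + r * c) =
        m * d + c + m * (r - 1) * (b * c - a * d) := by
      linear_combination (m * d + c) * hab
    rw [hid]
    linarith
  · intro h
    -- With `c = a * T` the exponents must sum to `b * T`. All but the `i`-th take the least value
    -- `E`, and the `i`-th takes the rest.
    refine ⟨fun t => if t = i then b * T - (r - 1) * E else E, a * T, fun t => ?_, ?_⟩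
    · by_cases hti : t = i
      · simp only [hti, if_true]
        linarith
      · simp only [hti, if_false]
        linarith
    · rw [sum_ite_eq_else_const]
      linear_combination T * hab

end

/-! ### The generator `z`, the ceiling criteria and the conclusion. -/

section

open FnPlace

variable {K F : Type*} [Field K] [Field F] [Algebra K F] {r : ℕ}

/-- If `y ^ m = ∏ (x - α_i) ^ λ` with `λ` prime to `m`, then `K(x, y)` is also generated by `x` and
an `m`-th root of `∏ (x - α_i)`. -/
theorem exists_isKummerCover {p m : ℕ} {lam : ℤ} [CharP K p] (hm : 0 < m)
    (hpm : Nat.gcd p m = 1) (hgcd : Int.gcd (m : ℤ) ((r : ℤ) * lam) = 1)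
    {α : Fin r → K} (hα : Function.Injective α) {x y : F} (hx : Transcendental K x)
    (hxy : y ^ m = ∏ i, (x - algebraMap K F (α i)) ^ lam)
    (hgen : IntermediateField.adjoin K {x, y} = ⊤) : ∃ z : F, IsKummerCover α x z m := by
  have hcop : IsCoprime (m : ℤ) (r * lam) := Int.isCoprime_iff_gcd_eq_one.2 hgcd
  have hr : IsCoprime (r : ℤ) m := hcop.of_mul_right_left.symm
  -- From `w * m + u * lam = 1`, the element `z = y ^ u * f ^ w` satisfies both `z ^ m = f` and `z ^
  -- lam = y`, so it generates the same field.
  obtain ⟨w, u, huw⟩ := hcop.of_mul_right_right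
  set f : F := ∏ i, (x - algebraMap K F (α i)) with hf
  have hf0 : f ≠ 0 := Finset.prod_ne_zero_iff.2 fun i _ h0 => hx <| by
    rw [sub_eq_zero.1 h0]
    exact isAlgebraic_algebraMap _
  rw [Finset.prod_zpow, ← hf] at hxy
  have hy0 : y ≠ 0 := by
    rintro rfl
    rw [zero_pow hm.ne'] at hxy
    exact zpow_ne_zero _ hf0 hxy.symm
  have hxy' : y ^ (m : ℤ) = f ^ lam := by exact_mod_cast hxy
  have hzm : (y ^ u * f ^ w) ^ m = f := by
    have h1 : (y ^ u * f ^ w) ^ (m : ℤ) = f := by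
      rw [mul_zpow, ← zpow_mul, mul_comm u, zpow_mul, hxy', ← zpow_mul, ← zpow_mul, ← zpow_add₀ hf0,
        show lam * u + w * m = 1 by linarith, zpow_one]
    exact_mod_cast h1
  have hzl : (y ^ u * f ^ w) ^ lam = y := by
    rw [mul_zpow, ← zpow_mul, ← zpow_mul, mul_comm w, zpow_mul f, ← hxy', ← zpow_mul,
      ← zpow_add₀ hy0, show u * lam + m * w = 1 by linarith, zpow_one]
  refine ⟨y ^ u * f ^ w, hm, ?_, hr, hα, hx, hzm, ?_⟩
  · intro h0
    have hpm' := Nat.dvd_gcd dvd_rfl ((CharP.cast_eq_zero_iff K p m).1 h0)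
    rw [hpm, Nat.dvd_one] at hpm'
    exact CharP.char_ne_one K p hpm'
  · rw [eq_top_iff, ← hgen, IntermediateField.adjoin_le_iff]
    have hxmem : x ∈ IntermediateField.adjoin K {x, y ^ u * f ^ w} :=
      IntermediateField.subset_adjoin _ _ (by simp)
    have hzmem : y ^ u * f ^ w ∈ IntermediateField.adjoin K {x, y ^ u * f ^ w} :=
      IntermediateField.subset_adjoin _ _ (by simp)
    rintro t (rfl | rfl)
    · exact hxmem
    · have := zpow_mem hzmem lam
      rwa [hzl] at this

namespace IsKummerCover

variable {α : Fin r → K} {x z : F} {m : ℕ} {P : Fin r → FnPlace K F} {Pinf : FnPlace K F}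

theorem attainsAt_zero_zero_iff (h : IsKummerCover α x z m)
    (hP : ∀ i, 0 < (P i).ord (x - algebraMap K F (α i))) (hPinf : Pinf.ord x < 0)
    {i j : Fin r} (hij : i ≠ j) (k l : ℤ) :
    AttainsAt (Finsupp.single (P i) k + Finsupp.single (P j) l) (P i) ↔
    (m : ℤ) * ⌈((k - l : ℤ) : ℚ) / (m : ℚ)⌉ + (m : ℤ) * ((r : ℤ) - 2) * ⌈(k : ℚ) / (m : ℚ)⌉ ≤
      k * r := by
  classical
  rw [h.attainsAt_zero_iff hP hPinf, ← exists_exponents_zero_zero_iff h.pos hij]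
  · simp [Finsupp.single_apply, (h.places_injective hP).eq_iff, h.zero_ne_infty hP hPinf, hij.symm,
      eq_comm (b := i), eq_comm (b := j)]
  · intro Q hQ _
    simp [(hQ _).symm]

theorem attainsAt_zero_infty_iff (h : IsKummerCover α x z m)
    (hP : ∀ i, 0 < (P i).ord (x - algebraMap K F (α i))) (hPinf : Pinf.ord x < 0)
    (i : Fin r) (k T : ℤ) :
    AttainsAt (Finsupp.single (P i) k + Finsupp.single Pinf T) (P i) ↔
    (m : ℤ) * ((r : ℤ) - 1) * ⌈(k : ℚ) / (m : ℚ)⌉ ≤ T + k * r := by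
  classical
  rw [h.attainsAt_zero_iff hP hPinf, ← exists_exponents_zero_infty_iff h.pos i]
  · simp [Finsupp.single_apply, (h.places_injective hP).eq_iff, h.zero_ne_infty hP hPinf,
      (h.zero_ne_infty hP hPinf _).symm, eq_comm (b := i)]
  · intro Q hQ hQ'
    simp [(hQ _).symm, hQ'.symm]

theorem attainsAt_infty_iff_ceil (h : IsKummerCover α x z m)
    (hP : ∀ i, 0 < (P i).ord (x - algebraMap K F (α i))) (hPinf : Pinf.ord x < 0)
    (i : Fin r) (k T : ℤ) {a b : ℤ} (hab : a * r + b * m = 1) :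
    AttainsAt (Finsupp.single (P i) k + Finsupp.single Pinf T) Pinf ↔
    (m : ℤ) * ((r : ℤ) - 1) * ⌈((-(a * T) : ℤ) : ℚ) / (m : ℚ)⌉ ≤ k + (a + b * m) * T := by
  classical
  rw [h.attainsAt_infty_iff hP hPinf _ i, ← exists_exponents_infty_iff h.pos i k T hab]
  · simp [Finsupp.single_apply, (h.places_injective hP).eq_iff, h.zero_ne_infty hP hPinf,
      (h.zero_ne_infty hP hPinf _).symm, eq_comm (b := i)]
  · intro Q hQ hQ'
    simp [(hQ _).symm, hQ'.symm]

end IsKummerCover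

end

theorem corollary4p5
    {K F : Type*} [Field K] [Finite K] [Field F] [Algebra K F]
    (p : ℕ) [CharP K p] (m r : ℕ) (lam : ℤ)
    (hm : 2 ≤ m) (hr : 1 ≤ r) (hpm : Nat.gcd p m = 1)
    (hgcd : Int.gcd (m : ℤ) ((r : ℤ) * lam) = 1)
    -- the distinct roots `α_1, …, α_r`
    (α : Fin r → K) (hα : Function.Injective α)
    -- `F = K(x, y)` with `x` transcendental and `y ^ m = ∏ (x - α_i) ^ λ`
    (x y : F) (hx : Transcendental K x)
    (hxy : y ^ m = ∏ i, (x - algebraMap K F (α i)) ^ lam)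
    (hgen : IntermediateField.adjoin K {x, y} = ⊤)
    -- `P i` is the zero of `x - α_i` and `Pinf` is the place at infinity
    (P : Fin r → FnPlace K F) (hP : ∀ i, 0 < (P i).ord (x - algebraMap K F (α i)))
    (Pinf : FnPlace K F) (hPinf : Pinf.ord x < 0)
    (a b : ℤ) (hab : a * r + b * m = 1) :
    (∀ i j : Fin r, i ≠ j →
      weierstrassSemigroup ![P i, P j] =
        {s : Fin 2 → ℕ |
          (m : ℤ) * ⌈((s 0 : ℚ) - (s 1 : ℚ)) / (m : ℚ)⌉
              + (m : ℤ) * ((r : ℤ) - 2) * ⌈(s 0 : ℚ) / (m : ℚ)⌉ ≤ (s 0 : ℤ) * (r : ℤ) ∧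
          (m : ℤ) * ⌈((s 1 : ℚ) - (s 0 : ℚ)) / (m : ℚ)⌉
              + (m : ℤ) * ((r : ℤ) - 2) * ⌈(s 1 : ℚ) / (m : ℚ)⌉ ≤ (s 1 : ℤ) * (r : ℤ)}) ∧
    (∀ i j : Fin r, i ≠ j →
      pureGapSet ![P i, P j] =
        {s : Fin 2 → ℕ | (0 < s 0 ∧ 0 < s 1) ∧
          (m : ℤ) * ⌈((s 0 : ℚ) - (s 1 : ℚ)) / (m : ℚ)⌉
              + (m : ℤ) * ((r : ℤ) - 2) * ⌈(s 0 : ℚ) / (m : ℚ)⌉ > (s 0 : ℤ) * (r : ℤ) ∧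
          (m : ℤ) * ⌈((s 1 : ℚ) - (s 0 : ℚ)) / (m : ℚ)⌉
              + (m : ℤ) * ((r : ℤ) - 2) * ⌈(s 1 : ℚ) / (m : ℚ)⌉ > (s 1 : ℤ) * (r : ℤ)}) ∧
    (∀ i : Fin r,
      weierstrassSemigroup ![P i, Pinf] =
        {s : Fin 2 → ℕ |
          (m : ℤ) * ((r : ℤ) - 1) * ⌈(s 0 : ℚ) / (m : ℚ)⌉ ≤ (s 1 : ℤ) + (s 0 : ℤ) * (r : ℤ) ∧
          (m : ℤ) * ((r : ℤ) - 1) * ⌈-((a : ℚ) * (s 1 : ℚ)) / (m : ℚ)⌉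
            ≤ (s 0 : ℤ) + (a + b * (m : ℤ)) * (s 1 : ℤ)}) ∧
    (∀ i : Fin r,
      pureGapSet ![P i, Pinf] =
        {s : Fin 2 → ℕ | (0 < s 0 ∧ 0 < s 1) ∧
          (m : ℤ) * ((r : ℤ) - 1) * ⌈(s 0 : ℚ) / (m : ℚ)⌉ > (s 1 : ℤ) + (s 0 : ℤ) * (r : ℤ) ∧
          (m : ℤ) * ((r : ℤ) - 1) * ⌈-((a : ℚ) * (s 1 : ℚ)) / (m : ℚ)⌉
            > (s 0 : ℤ) + (a + b * (m : ℤ)) * (s 1 : ℤ)}) := by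
  obtain ⟨z, h⟩ := exists_isKummerCover (zero_lt_two.trans_le hm) hpm hgcd hα hx hxy hgen
  have hne := h.places_injective hP
  have hzz : ∀ i j : Fin r, i ≠ j → ∀ s : Fin 2 → ℕ,
      (AttainsAt (sumDivisor ![P i, P j] s) (P i) ↔
        (m : ℤ) * ⌈((s 0 : ℚ) - (s 1 : ℚ)) / (m : ℚ)⌉
          + (m : ℤ) * ((r : ℤ) - 2) * ⌈(s 0 : ℚ) / (m : ℚ)⌉ ≤ (s 0 : ℤ) * (r : ℤ)) ∧
      (AttainsAt (sumDivisor ![P i, P j] s) (P j) ↔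
        (m : ℤ) * ⌈((s 1 : ℚ) - (s 0 : ℚ)) / (m : ℚ)⌉
          + (m : ℤ) * ((r : ℤ) - 2) * ⌈(s 1 : ℚ) / (m : ℚ)⌉ ≤ (s 1 : ℤ) * (r : ℤ)) := by
    intro i j hij s
    have h1 := h.attainsAt_zero_zero_iff hP hPinf hij (s 0) (s 1)
    have h2 := h.attainsAt_zero_zero_iff hP hPinf hij.symm (s 1) (s 0)
    rw [add_comm] at h2
    rw [sumDivisor_pair, h1, h2]
    push_cast
    exact ⟨Iff.rfl, Iff.rfl⟩
  have hzi : ∀ (i : Fin r) (s : Fin 2 → ℕ),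
      (AttainsAt (sumDivisor ![P i, Pinf] s) (P i) ↔
        (m : ℤ) * ((r : ℤ) - 1) * ⌈(s 0 : ℚ) / (m : ℚ)⌉ ≤ (s 1 : ℤ) + (s 0 : ℤ) * (r : ℤ)) ∧
      (AttainsAt (sumDivisor ![P i, Pinf] s) Pinf ↔
        (m : ℤ) * ((r : ℤ) - 1) * ⌈-((a : ℚ) * (s 1 : ℚ)) / (m : ℚ)⌉
          ≤ (s 0 : ℤ) + (a + b * (m : ℤ)) * (s 1 : ℤ)) := by
    intro i s
    rw [sumDivisor_pair, h.attainsAt_zero_infty_iff hP hPinf,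
      h.attainsAt_infty_iff_ceil hP hPinf i _ _ hab]
    push_cast
    exact ⟨Iff.rfl, Iff.rfl⟩
  have hfin : ∀ (Q₁ Q₂ : FnPlace K F), ((∃ i, Q₁ = P i) ∨ Q₁ = Pinf) →
      ((∃ i, Q₂ = P i) ∨ Q₂ = Pinf) → ∀ s : Fin 2 → ℕ,
      FiniteDimensional K (riemannRochSpace (sumDivisor ![Q₁, Q₂] s)) := by
    intro Q₁ Q₂ h1 h2 s
    refine h.finiteDimensional_riemannRochSpace hP hPinf _ fun Q hQ hQ' => ?_
    have key : ∀ R : FnPlace K F, ((∃ i, R = P i) ∨ R = Pinf) → Q ≠ R := by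
      rintro R (⟨i, rfl⟩ | rfl)
      · exact hQ i
      · exact hQ'
    rw [sumDivisor_pair, Finsupp.add_apply, Finsupp.single_eq_of_ne (key _ h1),
      Finsupp.single_eq_of_ne (key _ h2), add_zero]
  refine ⟨fun i j hij => ?_, fun i j hij => ?_, fun i => ?_, fun i => ?_⟩ <;> ext s
  · rw [mem_weierstrassSemigroup_pair_iff (hne.ne hij), (hzz i j hij s).1, (hzz i j hij s).2]
    rfl
  · have := hfin (P i) (P j) (.inl ⟨i, rfl⟩) (.inl ⟨j, rfl⟩) s
    rw [mem_pureGapSet_pair_iff, (hzz i j hij s).1, (hzz i j hij s).2, not_le, not_le]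
    rfl
  · rw [mem_weierstrassSemigroup_pair_iff (h.zero_ne_infty hP hPinf i), (hzi i s).1, (hzi i s).2]
    rfl
  · have := hfin (P i) Pinf (.inl ⟨i, rfl⟩) (.inr rfl) s
    rw [mem_pureGapSet_pair_iff, (hzi i s).1, (hzi i s).2, not_le, not_le]
    rfl

end
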